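/- Let $x,y\in\{0,1\}^n$, and let $\|x-y\|_1$ denote their Hamming distance. In a randomized two-party protocol Alice holds $x$, Bob holds $y$, and they may use public coins $R$ (a discrete random source, known to both players and independent of the inputs) as well as private coins. For a given value of $R$ the protocol is a finite binary tree: at each inner node one player sends a bit (depending on their own input, on the node and on private coins), and at each leaf one of the players declares the output, depending on their own input, on the leaf and on private coins. Let $\Pi$ be the sequence of bits exchanged. For a distribution $\mu$ of the inputs $(X,Y)$, the internal information cost of a protocol $P$ is $$\mathsf{IC}_\mu(P)=I(\Pi;Y\mid X,R)+I(\Pi;X\mid Y,R),\qquad (X,Y)\sim\mu,$$ measured in bits (equivalently, $R$ is counted as a part of the transcript). Let $\mu_k$ be the distribution of the pair $(x,y)$ where $x$ is uniform on $\{0,1\}^n$ and $y$ is obtained from $x$ by flipping $k$ coordinates chosen independently and uniformly at random, with replacement. **Theorem.** There are absolute constants $c>0$ and $\delta_0>0$ such that the following holds. Let $n,k\ge 1$ be integers and let $0<\delta\le\delta_0$ with $k^2\le\delta n$. Let $P$ be a randomized protocol on inputs from $\{0,1\}^n\times\{0,1\}^n$ that outputs $1$ with probability at least $1-\delta$ on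 every pair $(x,y)$ with $\|x-y\|_1=k$, and outputs $0$ with probability at least $1-\delta$ on every pair $(x,y)$ with $\|x-y\|_1\in\{k-2,k+2\}$ (its answers on all other pairs are arbitrary). Then $$\mathsf{IC}_{\mu_k}(P)\ \ge\ c\,k\log_2\frac{k}{\delta}.$$ -/

import Mathlib

/-- A two-party communication protocol with private coins, as a finite binary protocol tree.
Alice holds an input in `X` and Bob an input in `Y`. At an inner node its owner sends one bit,
which is `true` with the given probability (depending on the owner's input and, through the
node, on all bits exchanged so far), drawn with fresh private randomness. At a leaf the
communication is over, and one of the players, depending on their own input, declares the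
output, which is `true` (that is, `1`) with the given probability. Probabilities `0` and `1`
throughout give deterministic protocols. -/
inductive ProtocolTree (X Y : Type) : Type
  | aliceOutputs (f : X → unitInterval) : ProtocolTree X Y
  | bobOutputs (g : Y → unitInterval) : ProtocolTree X Y
  | aliceSends (p : X → unitInterval) (next : Bool → ProtocolTree X Y) : ProtocolTree X Y
  | bobSends (q : Y → unitInterval) (next : Bool → ProtocolTree X Y) : ProtocolTree X Y

/-- A randomized protocol with public and private coins: a (discrete) distribution on protocol
trees with private coins. The sampled tree is what the public coins determine. -/
abbrev RandomizedProtocol (X Y : Type) : Type := PMF (ProtocolTree X Y)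

/-- A coin that is `true` with probability `p`. -/
noncomputable def biasedCoin (p : unitInterval) : PMF Bool :=
  PMF.ofFintype (fun b => ENNReal.ofReal (cond b (p : ℝ) (1 - p))) (by
    rw [Fintype.sum_bool, cond_true, cond_false,
      ← ENNReal.ofReal_add p.2.1 (sub_nonneg.2 p.2.2), add_sub_cancel, ENNReal.ofReal_one])

/-- The joint distribution of the transcript (the sequence of bits exchanged) and the output
of a protocol tree on the inputs `x`, `y`. -/
noncomputable def ProtocolTree.run {X Y : Type} :
    ProtocolTree X Y → X → Y → PMF (List Bool × Bool)
  | .aliceOutputs f, x, _ => (biasedCoin (f x)).map fun o => ([], o)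
  | .bobOutputs g, _, y => (biasedCoin (g y)).map fun o => ([], o)
  | .aliceSends p next, x, y =>
      (biasedCoin (p x)).bind fun b => ((next b).run x y).map fun t => (b :: t.1, t.2)
  | .bobSends q next, x, y =>
      (biasedCoin (q y)).bind fun b => ((next b).run x y).map fun t => (b :: t.1, t.2)

/-- The distribution of the output of a randomized protocol on the inputs `x`, `y`, over the
public and the private coins. -/
noncomputable def RandomizedProtocol.output {X Y : Type} (P : RandomizedProtocol X Y)
    (x : X) (y : Y) : PMF Bool :=
  P.bind fun T => (T.run x y).map Prod.snd

/-- The conditional mutual information `I(A ; B | C)`, in bits, of jointly distributed discrete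
random variables `(A, B, C)` with joint law `P`: the expectation of
`log₂ (ℙ(A,B|C) / (ℙ(A|C) ℙ(B|C)))`. -/
noncomputable def condMutualInfo {α β γ : Type} (P : PMF (α × β × γ)) : ℝ :=
  ∑' t : α × β × γ, (P t).toReal *
    Real.logb 2
      (((P t).toReal / ((P.map fun s => s.2.2) t.2.2).toReal) /
        ((((P.map fun s => (s.1, s.2.2)) (t.1, t.2.2)).toReal /
            ((P.map fun s => s.2.2) t.2.2).toReal) *
          (((P.map fun s => s.2) t.2).toReal / ((P.map fun s => s.2.2) t.2.2).toReal)))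

/-- The joint law of `(X, Y, Π)`, where the inputs `(X, Y)` are drawn from `μ` and `Π` is the
transcript of the protocol tree `T` on these inputs. -/
noncomputable def ProtocolTree.jointLaw {X Y : Type} (T : ProtocolTree X Y) (μ : PMF (X × Y)) :
    PMF (X × Y × List Bool) :=
  μ.bind fun z => (T.run z.1 z.2).map fun t => (z.1, z.2, t.1)

/-- The internal information cost `I(Π ; Y | X) + I(Π ; X | Y)` of a protocol tree. -/
noncomputable def ProtocolTree.infoCost {X Y : Type} (T : ProtocolTree X Y) (μ : PMF (X × Y)) :
    ℝ :=
  condMutualInfo ((T.jointLaw μ).map fun s => (s.2.2, s.2.1, s.1)) +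
    condMutualInfo ((T.jointLaw μ).map fun s => (s.2.2, s.1, s.2.1))

/-- The internal information cost of a randomized protocol. The public coins `R` are known to
both players and independent of the inputs, and the information is measured given `R`: this
is `I(Π ; Y | X, R) + I(Π ; X | Y, R)`, the expectation over the value of `R` of the cost of
the tree that it determines (equivalently, `R` is made a part of the transcript). -/
noncomputable def RandomizedProtocol.infoCost {X Y : Type} (P : RandomizedProtocol X Y)
    (μ : PMF (X × Y)) : ℝ :=
  ∑' T : ProtocolTree X Y, (P T).toReal * T.infoCost μ

/-- Flip the coordinates `i 0, …, i (k - 1)` of `x` one after the other: coordinate `j` is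
reversed if and only if it occurs an odd number of times. -/
def flipCoords {n k : ℕ} (x : Fin n → Bool) (i : Fin k → Fin n) : Fin n → Bool :=
  fun j => xor (x j) (decide (Odd (Finset.univ.filter fun t => i t = j).card))

/-- The distribution `μ_k` on pairs `(x, y)` of `n`-bit strings: `x` is uniform, and `y` is
obtained from `x` by flipping `k` coordinates chosen independently and uniformly at random,
with replacement. -/
noncomputable def walkPair (n k : ℕ) [NeZero n] : PMF ((Fin n → Bool) × (Fin n → Bool)) :=
  (PMF.uniformOfFintype (Fin n → Bool)).bind fun x =>
    (PMF.uniformOfFintype (Fin k → Fin n)).map fun i => (x, flipCoords x i)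

/-!
By the rectangle property, the probability that the protocol reaches a given leaf and declares a
given output is `f x * g y`. Let `S` be the transition matrix of the simple random walk on the
cube. The information revealed by the rectangle `f x * g y` under `S ^ k` telescopes along the walk
into `k` terms. The `i`-th term is a relative entropy with respect to the walks of length `k + 2`,
namely that of the walk obtained by inserting a backward step at time `i + 1` into a walk of length
`k`; the ends of all these walks are weighted by `f` and `g`.

If `f` and `g` give the walks of length `k + 2` only an `ε` fraction of the weight of the walks of
length `k`, then already the mixture of the insertions over an interval of times has relative
entropy at least `log (1 / ε)`. Moreover, insertions at different times can be told apart: halfway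
between two insertion times one walk lags two steps behind the other, so their overlap is at most
the geometric mean of the weights of the walks of lengths `k + 2` and `k - 2`. If the latter weight
is small as well, a single insertion therefore has on average about `log k` more relative entropy
than the mixture, and the `k` terms together give `k * log (k / ε)`. The resulting bound is linear
in the rectangle, so it can be summed over the leaves and averaged over the public coins.
-/

namespace InfoCost

open Real Finset
open scoped Matrix

/-! ### The function `-x log x` -/

section NegMulLog

variable {a b : ℝ}

theorem negMulLog_add_le (ha : 0 ≤ a) (hb : 0 ≤ b) :
    negMulLog (a + b) ≤ negMulLog a + negMulLog b := by
  have mul_log_le {u v : ℝ} (hu : 0 ≤ u) (hv : 0 ≤ v) : u * log u ≤ u * log (u + v) := by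
    rcases hu.eq_or_lt with rfl | hu
    · simp
    · gcongr
      linarith
  have h₁ := mul_log_le ha hb
  have h₂ := mul_log_le hb ha
  rw [add_comm b a] at h₂
  simp only [negMulLog]
  linarith

theorem negMulLog_sum_le {ι : Type*} (s : Finset ι) {u : ι → ℝ} (hu : ∀ i ∈ s, 0 ≤ u i) :
    negMulLog (∑ i ∈ s, u i) ≤ ∑ i ∈ s, negMulLog (u i) :=
  le_sum_of_subadditive_on_pred negMulLog (fun x => 0 ≤ x) negMulLog_zero.le
    (fun _ _ => negMulLog_add_le) (fun _ _ => add_nonneg) u hu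

theorem negMulLog_div_two (x : ℝ) : negMulLog (x / 2) = negMulLog x / 2 + x / 2 * log 2 := by
  rw [div_eq_mul_inv, negMulLog_mul, negMulLog, negMulLog, log_inv]
  ring

theorem negMulLog_add_negMulLog_le (ha : 0 ≤ a) (hb : 0 ≤ b) :
    negMulLog a + negMulLog b ≤ negMulLog (a + b) + (a + b) * log 2 := by
  have h := concaveOn_negMulLog.right ha hb one_half_pos.le one_half_pos.le (add_halves 1)
  simp only [smul_eq_mul, one_div_mul_eq_div, ← add_div, negMulLog_div_two] at h
  linarith

theorem log_one_add_sq_le {t : ℝ} (ht : 0 ≤ t) : log (1 + t ^ 2) ≤ 2 * t :=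
  calc log (1 + t ^ 2) ≤ log ((1 + t) ^ 2) := log_le_log (by positivity) (by nlinarith)
    _ = 2 * log (1 + t) := by rw [log_pow, Nat.cast_ofNat]
    _ ≤ 2 * t := by linarith [log_le_sub_one_of_pos (x := 1 + t) (by positivity)]

theorem mul_log_add_sub_log_le (ha : 0 ≤ a) (hb : 0 ≤ b) :
    a * (log (a + b) - log a) ≤ 2 * √(a * b) := by
  rcases ha.eq_or_lt with rfl | ha
  · simp
  have ratio : (a + b) / a = 1 + √(b / a) ^ 2 := by
    rw [sq_sqrt (by positivity)]
    field_simp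
  have scale : a * √(b / a) = √(a * b) := by
    rw [← sqrt_sq ha.le, ← sqrt_mul (by positivity), sqrt_sq ha.le]
    congr 1
    field_simp
  rw [← log_div (by positivity) ha.ne', ratio, ← scale]
  nlinarith [log_one_add_sq_le (sqrt_nonneg (b / a))]

theorem negMulLog_avg_add_le (ha : 0 ≤ a) (hb : 0 ≤ b) :
    (negMulLog a + negMulLog b) / 2 + ((a + b) / 2 * log 2 - 2 * √(a * b)) ≤
      negMulLog ((a + b) / 2) := by
  have h₁ := mul_log_add_sub_log_le ha hb
  have h₂ := mul_log_add_sub_log_le hb ha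
  rw [add_comm b a, mul_comm b a] at h₂
  rw [negMulLog_div_two]
  simp only [negMulLog]
  linarith

end NegMulLog

/-! ### Entropy of mixtures -/

section Mixtures

variable {Ω V E : Type*}

/-- The average of the `2 ^ r` consecutive terms `u a, …, u (a + 2 ^ r - 1)`. -/
noncomputable def dyadicMean [AddCommGroup E] [Module ℝ E] (u : ℕ → E) (a r : ℕ) : E :=
  ((2 : ℝ) ^ r)⁻¹ • ∑ i ∈ range (2 ^ r), u (a + i)

theorem dyadicMean_zero [AddCommGroup E] [Module ℝ E] (u : ℕ → E) (a : ℕ) :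
    dyadicMean u a 0 = u a := by
  simp [dyadicMean]

theorem dyadicMean_succ [AddCommGroup E] [Module ℝ E] (u : ℕ → E) (a r : ℕ) :
    dyadicMean u a (r + 1) = midpoint ℝ (dyadicMean u a r) (dyadicMean u (a + 2 ^ r) r) := by
  simp only [dyadicMean, midpoint_eq_smul_add, pow_succ 2, mul_two (2 ^ r), sum_range_add,
    add_assoc, ← smul_add, smul_smul, invOf_eq_inv, pow_succ (2 : ℝ), mul_inv_rev]

theorem dyadicMean_nonneg {ψ : ℕ → Ω → ℝ} (hψ : ∀ i w, 0 ≤ ψ i w) (a r : ℕ) (w : Ω) :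
    0 ≤ dyadicMean ψ a r w := by
  simp only [dyadicMean, Pi.smul_apply, Finset.sum_apply, smul_eq_mul]
  exact mul_nonneg (by positivity) (sum_nonneg fun i _ => hψ _ w)

theorem sum_mul_dyadicMean {s : Finset Ω} {R : Ω → ℝ} {ψ : ℕ → Ω → ℝ} {a r : ℕ} {c : ℝ}
    (h : ∀ i, a ≤ i → i < a + 2 ^ r → ∑ w ∈ s, R w * ψ i w = c) :
    ∑ w ∈ s, R w * dyadicMean ψ a r w = c := by
  have swap : ∑ w ∈ s, R w * dyadicMean ψ a r w =
      ((2 : ℝ) ^ r)⁻¹ * ∑ i ∈ range (2 ^ r), ∑ w ∈ s, R w * ψ (a + i) w := by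
    simp only [dyadicMean, Pi.smul_apply, Finset.sum_apply, smul_eq_mul, mul_left_comm (R _),
      ← mul_sum]
    rw [sum_comm]
    simp only [mul_sum]
  rw [swap, sum_congr rfl fun i hi =>
    h (a + i) (by omega) (by have := mem_range.1 hi; omega)]
  simp

variable [Fintype Ω] {R p q : Ω → ℝ} {m β : ℝ} {ψ : ℕ → Ω → ℝ}

/-- The differential entropy (in nats) of the density `p` with respect to the weights `R`. The
total mass `∑ w, R w * p w` is not required to be `1`. -/
noncomputable def weightedEntropy (R p : Ω → ℝ) : ℝ :=
  ∑ w, R w * negMulLog (p w)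

theorem weightedEntropy_le (hR : ∀ w, 0 ≤ R w) (hR' : 0 < ∑ w, R w) (hp : ∀ w, 0 ≤ p w) :
    weightedEntropy R p ≤ (∑ w, R w * p w) * log ((∑ w, R w) / ∑ w, R w * p w) := by
  have jensen := concaveOn_negMulLog.le_map_centerMass (t := univ) (fun w _ => hR w) hR'
    (fun w _ => Set.mem_Ici.2 (hp w))
  simp only [centerMass, smul_eq_mul, Function.comp_apply] at jensen
  rw [inv_mul_le_iff₀ hR'] at jensen
  refine jensen.trans_eq ?_
  have flip : log ((∑ w, R w) / ∑ w, R w * p w) = -log ((∑ w, R w)⁻¹ * ∑ w, R w * p w) := by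
    rw [← log_inv, mul_inv, inv_inv, div_eq_mul_inv]
  rw [flip, negMulLog]
  field_simp

theorem weightedEntropy_midpoint (hR : ∀ w, 0 ≤ R w) (hp : ∀ w, 0 ≤ p w) (hq : ∀ w, 0 ≤ q w)
    (hpm : ∑ w, R w * p w = m) (hqm : ∑ w, R w * q w = m) :
    midpoint ℝ (weightedEntropy R p) (weightedEntropy R q) +
        (m * log 2 - 2 * ∑ w, R w * √(p w * q w)) ≤
      weightedEntropy R (midpoint ℝ p q) := by
  have expand : midpoint ℝ (weightedEntropy R p) (weightedEntropy R q) +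
        (m * log 2 - 2 * ∑ w, R w * √(p w * q w)) =
      ∑ w, R w * ((negMulLog (p w) + negMulLog (q w)) / 2 +
        ((p w + q w) / 2 * log 2 - 2 * √(p w * q w))) := by
    have hm : m * log 2 = (∑ w, R w * p w + ∑ w, R w * q w) / 2 * log 2 := by
      rw [hpm, hqm]
      ring
    simp only [hm, midpoint_eq_smul_add, weightedEntropy, invOf_eq_inv, smul_eq_mul,
      ← sum_add_distrib, mul_sum, sum_mul, sum_div, ← sum_sub_distrib]
    exact sum_congr rfl fun w _ => by ring
  rw [expand]
  refine sum_le_sum fun w _ => mul_le_mul_of_nonneg_left ?_ (hR w)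
  have avg : midpoint ℝ p q w = (p w + q w) / 2 := by
    rw [midpoint_eq_smul_add, invOf_eq_inv, Pi.smul_apply, Pi.add_apply, smul_eq_mul,
      inv_mul_eq_div]
  rw [avg]
  exact negMulLog_avg_add_le (hp w) (hq w)

/-- Halving the block of indices `r` times: each merge of two halves that can be told apart gains
almost a full bit of entropy. -/
theorem dyadicMean_weightedEntropy_add_le {k : ℕ} (hR : ∀ w, 0 ≤ R w) (hψ : ∀ i w, 0 ≤ ψ i w)
    (hmass : ∀ i < k, ∑ w, R w * ψ i w = m)
    (hsep : ∀ a r, a + 2 ^ (r + 1) ≤ k →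
      ∑ w, R w * √(dyadicMean ψ a r w * dyadicMean ψ (a + 2 ^ r) r w) ≤ β) (r : ℕ) :
    ∀ a, a + 2 ^ r ≤ k →
      dyadicMean (fun i => weightedEntropy R (ψ i)) a r + r * (m * log 2 - 2 * β) ≤
        weightedEntropy R (dyadicMean ψ a r) := by
  induction r with
  | zero => intro a _; simp [dyadicMean_zero]
  | succ r ih =>
    intro a ha
    have hpos : 0 < 2 ^ r := by positivity
    rw [pow_succ, mul_two] at ha
    have mass (b : ℕ) (hb : b + 2 ^ r ≤ k) : ∑ w, R w * dyadicMean ψ b r w = m :=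
      sum_mul_dyadicMean fun i _ hi => hmass i (by omega)
    have left := ih a (by omega)
    have right := ih (a + 2 ^ r) (by omega)
    have merge := weightedEntropy_midpoint hR (dyadicMean_nonneg hψ a r)
      (dyadicMean_nonneg hψ (a + 2 ^ r) r) (mass a (by omega)) (mass _ (by omega))
    rw [← dyadicMean_succ] at merge
    rw [dyadicMean_succ]
    simp only [midpoint_eq_smul_add, invOf_eq_inv, smul_eq_mul] at merge ⊢
    push_cast
    linarith [hsep a r (by rwa [pow_succ, mul_two])]

theorem sum_mul_sqrt_mul_le_of_marginals [Fintype V] [DecidableEq V]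
    (hR : ∀ w, 0 ≤ R w) (hp : ∀ w, 0 ≤ p w) (hq : ∀ w, 0 ≤ q w) (τ : Ω → V) {P Q : V → ℝ}
    (hP : ∀ x, ∑ w with τ w = x, R w * p w = P x)
    (hQ : ∀ x, ∑ w with τ w = x, R w * q w = Q x) :
    ∑ w, R w * √(p w * q w) ≤ ∑ x, √(P x) * √(Q x) := by
  rw [← sum_fiberwise univ τ]
  refine sum_le_sum fun x _ => ?_
  have hRp (w : Ω) : 0 ≤ R w * p w := mul_nonneg (hR w) (hp w)
  have hRq (w : Ω) : 0 ≤ R w * q w := mul_nonneg (hR w) (hq w)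
  calc ∑ w with τ w = x, R w * √(p w * q w)
      = ∑ w with τ w = x, √(R w * p w) * √(R w * q w) := by
        refine sum_congr rfl fun w _ => ?_
        rw [← sqrt_mul (hRp w), mul_mul_mul_comm, sqrt_mul (mul_self_nonneg _),
          sqrt_mul_self (hR w)]
    _ ≤ √(∑ w with τ w = x, R w * p w) * √(∑ w with τ w = x, R w * q w) :=
        sum_sqrt_mul_sqrt_le _ hRp hRq
    _ = √(P x) * √(Q x) := by rw [hP, hQ]

theorem sum_mul_sqrt_dyadicMean_le [Fintype V] [DecidableEq V] {k : ℕ} (hR : ∀ w, 0 ≤ R w)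
    (hψ : ∀ i w, 0 ≤ ψ i w)
    (hsep : ∀ mid, 0 < mid → mid < k → ∃ (τ : Ω → V) (P Q : V → ℝ),
      (∀ i < mid, ∀ x, ∑ w with τ w = x, R w * ψ i w = P x) ∧
      (∀ i, mid ≤ i → i < k → ∀ x, ∑ w with τ w = x, R w * ψ i w = Q x) ∧
      ∑ x, √(P x) * √(Q x) ≤ β) {a r : ℕ} (ha : a + 2 ^ (r + 1) ≤ k) :
    ∑ w, R w * √(dyadicMean ψ a r w * dyadicMean ψ (a + 2 ^ r) r w) ≤ β := by
  rw [pow_succ, mul_two] at ha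
  have hpos : 0 < 2 ^ r := by positivity
  obtain ⟨τ, P, Q, hP, hQ, hPQ⟩ := hsep (a + 2 ^ r) (by omega) (by omega)
  exact (sum_mul_sqrt_mul_le_of_marginals hR (dyadicMean_nonneg hψ a r)
    (dyadicMean_nonneg hψ (a + 2 ^ r) r) τ
    (fun x => sum_mul_dyadicMean fun i _ hi => hP i hi x)
    (fun x => sum_mul_dyadicMean fun i hi hi' => hQ i hi (by omega) x)).trans hPQ

end Mixtures

/-! ### Path sums -/

section Paths

variable {V : Type*}

/-- The weight of a path with initial weights `f`, time-dependent transition weights `K` and final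
weights `g`. -/
def pathWeight {n : ℕ} (K : ℕ → Matrix V V ℝ) (f g : V → ℝ) (w : Fin (n + 1) → V) : ℝ :=
  f (w 0) * (∏ t : Fin n, K t (w t.castSucc) (w t.succ)) * g (w (Fin.last n))

theorem pathWeight_nonneg {n : ℕ} {K : ℕ → Matrix V V ℝ} {f g : V → ℝ}
    (hK : ∀ t x y, 0 ≤ K t x y) (hf : ∀ x, 0 ≤ f x) (hg : ∀ x, 0 ≤ g x) (w : Fin (n + 1) → V) :
    0 ≤ pathWeight K f g w :=
  mul_nonneg (mul_nonneg (hf _) (prod_nonneg fun _ _ => hK _ _ _)) (hg _)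

theorem pathWeight_cons {n : ℕ} (K : ℕ → Matrix V V ℝ) (f g : V → ℝ) (x : V)
    (w : Fin (n + 1) → V) :
    pathWeight K f g (Fin.cons x w : Fin (n + 2) → V) =
      pathWeight (fun t => K (t + 1)) (fun y => f x * K 0 x y) g w := by
  have shift (t : Fin n) :
      (Fin.cons x w : Fin (n + 2) → V) t.succ.castSucc = w t.castSucc := by
    rw [← Fin.succ_castSucc, Fin.cons_succ]
  simp only [pathWeight, Fin.prod_univ_succ, Fin.cons_zero, Fin.cons_succ, Fin.castSucc_zero,
    shift, ← Fin.succ_last, Fin.val_zero, Fin.val_succ]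
  ring

variable [Fintype V]

theorem sum_fin_succ_pi {n : ℕ} (F : (Fin (n + 1) → V) → ℝ) :
    ∑ w, F w = ∑ x, ∑ w : Fin n → V, F (Fin.cons x w) := by
  rw [← (Fin.consEquiv fun _ => V).sum_comp, Fintype.sum_prod_type]
  rfl

theorem sum_pathWeight_cons_mul {n : ℕ} (K : ℕ → Matrix V V ℝ) (f g : V → ℝ)
    (h : (Fin (n + 1) → V) → ℝ) :
    ∑ x, ∑ w : Fin (n + 1) → V, pathWeight K f g (Fin.cons x w : Fin (n + 2) → V) * h w =
      ∑ w, pathWeight (fun t => K (t + 1)) (f ᵥ* K 0) g w * h w := by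
  rw [sum_comm]
  simp only [pathWeight_cons]
  simp only [pathWeight, ← sum_mul]
  rfl

theorem sum_pathWeight {n : ℕ} (K : ℕ → Matrix V V ℝ) (f : V → ℝ) (B : ℕ → V → ℝ)
    (hB : ∀ t < n, B t = K t *ᵥ B (t + 1)) :
    ∑ w : Fin (n + 1) → V, pathWeight K f (B n) w = f ⬝ᵥ B 0 := by
  induction n generalizing K f B with
  | zero =>
    rw [← (Equiv.funUnique (Fin 1) V).symm.sum_comp]
    simp [pathWeight, dotProduct]
  | succ n ih =>
    have peel := sum_pathWeight_cons_mul (n := n) K f (B (n + 1)) fun _ => 1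
    simp only [mul_one] at peel
    rw [sum_fin_succ_pi, peel, ih _ _ (fun t => B (t + 1)) fun t ht => hB (t + 1) (by omega),
      hB 0 (by omega), Matrix.dotProduct_mulVec]

/-- With forward messages `A` and backward messages `B`, the marginal of the path weights at time
`t` is `A t * B t`. -/
theorem sum_pathWeight_mul {n : ℕ} (K : ℕ → Matrix V V ℝ) (A B : ℕ → V → ℝ)
    (hA : ∀ t < n, A (t + 1) = A t ᵥ* K t) (hB : ∀ t < n, B t = K t *ᵥ B (t + 1))
    (t : Fin (n + 1)) (h : V → ℝ) :
    ∑ w, pathWeight K (A 0) (B n) w * h (w t) = ∑ x, A t x * B t x * h x := by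
  induction n generalizing K A B with
  | zero =>
    obtain rfl : t = 0 := Fin.ext (by omega)
    rw [← (Equiv.funUnique (Fin 1) V).symm.sum_comp]
    simp [pathWeight]
  | succ n ih =>
    refine Fin.cases ?_ (fun t => ?_) t
    · have total := sum_pathWeight K (fun x => A 0 x * h x) B hB
      simp only [dotProduct, mul_right_comm _ (h _)] at total
      rw [Fin.val_zero, ← total]
      exact sum_congr rfl fun w _ => by simp only [pathWeight]; ring
    · have peel := sum_pathWeight_cons_mul K (A 0) (B (n + 1)) fun w => h (w t)
      rw [sum_fin_succ_pi]
      simp only [Fin.cons_succ, Fin.val_succ]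
      rw [peel, ← hA 0 (by omega)]
      exact ih (fun t => K (t + 1)) (fun t => A (t + 1)) (fun t => B (t + 1))
        (fun t ht => hA (t + 1) (by omega)) (fun t ht => hB (t + 1) (by omega)) t

end Paths

/-! ### Information about the input of the other player -/

section SideInfo

variable {V W : Type*} [Fintype V] [Fintype W]

/-- The unnormalized information (in nats) that an observation of likelihood `f x * g y` reveals
about `y` to someone who knows `x`, where `M x y` is the conditional probability of `y` given `x`.
Summed over all transcripts, it gives `I(Π ; Y | X)`. -/
noncomputable def sideInfo (M : Matrix V W ℝ) (f : V → ℝ) (g : W → ℝ) : ℝ :=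
  f ⬝ᵥ (negMulLog ∘ (M *ᵥ g) - M *ᵥ (negMulLog ∘ g))

variable {M : Matrix V W ℝ} {f : V → ℝ} {g g₁ g₂ : W → ℝ}

theorem sideInfo_smul_left (c : ℝ) : sideInfo M (c • f) g = c * sideInfo M f g :=
  smul_dotProduct c f _

theorem sideInfo_add_left (f₁ f₂ : V → ℝ) :
    sideInfo M (f₁ + f₂) g = sideInfo M f₁ g + sideInfo M f₂ g :=
  add_dotProduct f₁ f₂ _

theorem sideInfo_nonneg (hM : ∀ x y, 0 ≤ M x y) (hM₁ : ∀ x, ∑ y, M x y = 1)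
    (hf : ∀ x, 0 ≤ f x) (hg : ∀ y, 0 ≤ g y) : 0 ≤ sideInfo M f g :=
  dotProduct_nonneg_of_nonneg hf fun x => sub_nonneg.2 <|
    concaveOn_negMulLog.le_map_sum (fun y _ => hM x y) (hM₁ x) fun y _ => hg y

theorem dotProduct_mulVec_nonneg (hM : ∀ x y, 0 ≤ M x y) (hf : ∀ x, 0 ≤ f x)
    (hg : ∀ y, 0 ≤ g y) : 0 ≤ f ⬝ᵥ M *ᵥ g :=
  dotProduct_nonneg_of_nonneg hf fun x => dotProduct_nonneg_of_nonneg (hM x) hg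

/-- `I(Π ; Y | X) ≤ H(Y | X)`. -/
theorem sideInfo_le (hM : ∀ x y, 0 ≤ M x y) (hf : ∀ x, 0 ≤ f x) (hg : ∀ y, 0 ≤ g y) :
    sideInfo M f g ≤ f ⬝ᵥ M.map negMulLog *ᵥ g := by
  refine dotProduct_le_dotProduct_of_nonneg_left (fun x => ?_) hf
  calc negMulLog (∑ y, M x y * g y) - ∑ y, M x y * negMulLog (g y)
      ≤ ∑ y, negMulLog (M x y * g y) - ∑ y, M x y * negMulLog (g y) :=
        sub_le_sub_right (negMulLog_sum_le _ fun y _ => mul_nonneg (hM x y) (hg y)) _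
    _ = ∑ y, negMulLog (M x y) * g y := by
        rw [← sum_sub_distrib]
        exact sum_congr rfl fun y _ => by rw [negMulLog_mul]; ring

/-- Merging two observations loses at most one bit. -/
theorem sideInfo_add_sideInfo_le (hM : ∀ x y, 0 ≤ M x y) (hf : ∀ x, 0 ≤ f x)
    (hg₁ : ∀ y, 0 ≤ g₁ y) (hg₂ : ∀ y, 0 ≤ g₂ y) :
    sideInfo M f g₁ + sideInfo M f g₂ ≤
      sideInfo M f (g₁ + g₂) + (f ⬝ᵥ M *ᵥ (g₁ + g₂)) * log 2 := by
  have mass_nonneg {g : W → ℝ} (hg : ∀ y, 0 ≤ g y) (x : V) : 0 ≤ (M *ᵥ g) x :=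
    sum_nonneg fun y _ => mul_nonneg (hM x y) (hg y)
  have averages (x : V) : (M *ᵥ (negMulLog ∘ (g₁ + g₂))) x ≤
      (M *ᵥ (negMulLog ∘ g₁)) x + (M *ᵥ (negMulLog ∘ g₂)) x := by
    rw [← Pi.add_apply, ← Matrix.mulVec_add]
    exact sum_le_sum fun y _ =>
      mul_le_mul_of_nonneg_left (negMulLog_add_le (hg₁ y) (hg₂ y)) (hM x y)
  rw [sideInfo, sideInfo, sideInfo, ← dotProduct_add, mul_comm, ← smul_eq_mul, ← dotProduct_smul,
    ← dotProduct_add]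
  refine dotProduct_le_dotProduct_of_nonneg_left (fun x => ?_) hf
  have masses := negMulLog_add_negMulLog_le (mass_nonneg hg₁ x) (mass_nonneg hg₂ x)
  simp only [Pi.add_apply, Pi.sub_apply, Pi.smul_apply, Function.comp_apply, smul_eq_mul,
    Matrix.mulVec_add]
  linarith [averages x]

theorem continuous_sideInfo (M : Matrix V W ℝ) :
    Continuous fun p : (V → ℝ) × (W → ℝ) => sideInfo M p.1 p.2 := by
  simp only [sideInfo, dotProduct, Pi.sub_apply, Function.comp_apply, Matrix.mulVec]
  fun_prop

end SideInfo

section Symmetric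

variable {V : Type*} [Fintype V] {S : Matrix V V ℝ} {p q : V → ℝ}

theorem mulVec_dotProduct_of_isSymm (hS : S.IsSymm) (f g : V → ℝ) :
    (S *ᵥ f) ⬝ᵥ g = f ⬝ᵥ S *ᵥ g := by
  rw [Matrix.dotProduct_mulVec, ← Matrix.mulVec_transpose, hS.eq]

/-- The mean of `log (q / p)` with respect to the weights `p * q`. -/
noncomputable def meanLogRatio (p q : V → ℝ) : ℝ :=
  ∑ x, p x * q x * (log (q x) - log (p x))

theorem meanLogRatio_eq (p q : V → ℝ) :
    meanLogRatio p q = negMulLog ∘ p ⬝ᵥ q - p ⬝ᵥ negMulLog ∘ q := by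
  simp only [meanLogRatio, dotProduct, ← sum_sub_distrib, Function.comp_apply, negMulLog]
  exact sum_congr rfl fun x _ => by ring

theorem meanLogRatio_mulVec_sub (hS : S.IsSymm) (p q : V → ℝ) :
    meanLogRatio (S *ᵥ p) q - meanLogRatio p (S *ᵥ q) = sideInfo S p q + sideInfo S q p := by
  simp only [meanLogRatio_eq, sideInfo, dotProduct_comm q, dotProduct_sub, sub_dotProduct,
    mulVec_dotProduct_of_isSymm hS]
  ring

end Symmetric

/-! ### Inserting a backward step into a walk -/

section Insertion

variable {V : Type*} [Fintype V] [DecidableEq V] {S : Matrix V V ℝ} {f g : V → ℝ} {k i : ℕ}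

/-- The total weight of the walks of length `j` with transition weights `S` from a given vertex to
the final weights `f`. For symmetric `S` these are also the forward messages of walks with initial
weights `f`. -/
def message (S : Matrix V V ℝ) (f : V → ℝ) (j : ℕ) : V → ℝ :=
  S ^ j *ᵥ f

theorem message_zero (S : Matrix V V ℝ) (f : V → ℝ) : message S f 0 = f := by
  rw [message, pow_zero, Matrix.one_mulVec]

theorem message_succ (S : Matrix V V ℝ) (f : V → ℝ) (j : ℕ) :
    message S f (j + 1) = S *ᵥ message S f j := by
  rw [message, message, pow_succ', Matrix.mulVec_mulVec]

theorem message_succ_eq_vecMul (hS : S.IsSymm) (f : V → ℝ) (j : ℕ) :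
    message S f (j + 1) = message S f j ᵥ* S := by
  rw [message_succ, ← Matrix.vecMul_transpose, hS.eq]

theorem message_dotProduct_message (hS : S.IsSymm) (f g : V → ℝ) (i j : ℕ) :
    message S f i ⬝ᵥ message S g j = f ⬝ᵥ S ^ (i + j) *ᵥ g := by
  rw [message, message, mulVec_dotProduct_of_isSymm (hS.pow i), Matrix.mulVec_mulVec, pow_add]

theorem mulVec_pos_of_mem_rowStochastic {M : Matrix V V ℝ} (hM : M ∈ Matrix.rowStochastic ℝ V)
    (hf : ∀ x, 0 < f x) (x : V) : 0 < (M *ᵥ f) x := by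
  have hM₀ (y : V) : 0 ≤ M x y := Matrix.nonneg_of_mem_rowStochastic hM
  obtain ⟨y, -, hy⟩ := exists_ne_zero_of_sum_ne_zero
    ((Matrix.sum_row_of_mem_rowStochastic hM x).trans_ne one_ne_zero)
  exact sum_pos' (fun y _ => mul_nonneg (hM₀ y) (hf y).le)
    ⟨y, mem_univ y, mul_pos ((hM₀ y).lt_of_ne' hy) (hf y)⟩

theorem message_pos (hS : S ∈ Matrix.rowStochastic ℝ V) (hf : ∀ x, 0 < f x) (j : ℕ) (x : V) :
    0 < message S f j x :=
  mulVec_pos_of_mem_rowStochastic (pow_mem hS j) hf x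

theorem meanLogRatio_message_le_succ (hS : S ∈ Matrix.rowStochastic ℝ V) (hS' : S.IsSymm)
    (hf : ∀ x, 0 < f x) (hg : ∀ x, 0 < g x) (hi : i < k) :
    meanLogRatio (message S f i) (message S g (k - i)) ≤
      meanLogRatio (message S f (i + 1)) (message S g (k - (i + 1))) := by
  obtain ⟨j, rfl⟩ : ∃ j, k = i + 1 + j := ⟨k - (i + 1), by omega⟩
  rw [show i + 1 + j - i = j + 1 by omega, Nat.add_sub_cancel_left, message_succ, message_succ,
    ← sub_nonneg, meanLogRatio_mulVec_sub hS']
  have hS₀ (x y : V) : 0 ≤ S x y := Matrix.nonneg_of_mem_rowStochastic hS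
  have hf' (x : V) := (message_pos hS hf i x).le
  have hg' (x : V) := (message_pos hS hg j x).le
  exact add_nonneg (sideInfo_nonneg hS₀ (Matrix.sum_row_of_mem_rowStochastic hS) hf' hg')
    (sideInfo_nonneg hS₀ (Matrix.sum_row_of_mem_rowStochastic hS) hg' hf')

theorem meanLogRatio_message_le (hS : S ∈ Matrix.rowStochastic ℝ V) (hS' : S.IsSymm)
    (hf : ∀ x, 0 < f x) (hg : ∀ x, 0 < g x) (hi : i ≤ k) :
    meanLogRatio (message S f i) (message S g (k - i)) ≤ meanLogRatio (message S f k) g := by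
  induction hi using Nat.decreasingInduction with
  | self => rw [Nat.sub_self, message_zero]
  | of_succ j hj ih => exact (meanLogRatio_message_le_succ hS hS' hf hg hj).trans ih

/-- The factor by which the weight of a step from `a` to `b` is changed at time `i + 1`: it turns
the step into one that goes from time `i + 1` back to time `i` of a walk of length `k`. -/
noncomputable def insertionRatio (S : Matrix V V ℝ) (f g : V → ℝ) (k i : ℕ) (a b : V) : ℝ :=
  message S g (k - (i + 1)) a * message S f i b / (message S f (i + 1) a * message S g (k - i) b)

/-- The time-dependent transition weights `S`, multiplied by `insertionRatio` at time `i + 1`. -/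
noncomputable def insertionKernel (S : Matrix V V ℝ) (f g : V → ℝ) (k i t : ℕ) : Matrix V V ℝ :=
  Matrix.of fun a b => S a b * if t = i + 1 then insertionRatio S f g k i a b else 1

/-- The density, relative to the walks of length `k + 2`, of the following walk: it goes along a
walk of length `k` up to time `i + 1`, back along the last edge, and then completes a walk of
length `k` from the vertex reached at time `i`. -/
noncomputable def insertionDensity (S : Matrix V V ℝ) (f g : V → ℝ) (k i : ℕ)
    (w : Fin (k + 2 + 1) → V) : ℝ :=
  ∏ t : Fin (k + 2),
    if (t : ℕ) = i + 1 then insertionRatio S f g k i (w t.castSucc) (w t.succ) else 1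

theorem insertionDensity_eq (hi : i < k) (w : Fin (k + 2 + 1) → V) :
    insertionDensity S f g k i w =
      insertionRatio S f g k i (w ⟨i + 1, by omega⟩) (w ⟨i + 2, by omega⟩) := by
  rw [insertionDensity, prod_eq_single ⟨i + 1, by omega⟩
    (fun t _ ht => if_neg fun h => ht (Fin.ext h)) (by simp), if_pos rfl]
  rfl

theorem insertionDensity_pos (hu : ∀ j x, 0 < message S f j x) (hv : ∀ j x, 0 < message S g j x)
    (w : Fin (k + 2 + 1) → V) : 0 < insertionDensity S f g k i w := by
  refine prod_pos fun t _ => ?_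
  split_ifs
  · exact div_pos (mul_pos (hv _ _) (hu _ _)) (mul_pos (hu _ _) (hv _ _))
  · exact one_pos

theorem pathWeight_insertionKernel (w : Fin (k + 2 + 1) → V) :
    pathWeight (insertionKernel S f g k i) f g w =
      pathWeight (fun _ => S) f g w * insertionDensity S f g k i w := by
  simp only [pathWeight, insertionKernel, insertionDensity, Matrix.of_apply, prod_mul_distrib]
  ring

theorem insertionKernel_of_ne {t : ℕ} (ht : t ≠ i + 1) : insertionKernel S f g k i t = S := by
  ext a b
  simp [insertionKernel, ht]

/-- The forward messages of the walk with an inserted backward step. -/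
def insertionForward (S : Matrix V V ℝ) (f : V → ℝ) (i t : ℕ) : V → ℝ :=
  message S f (if t ≤ i + 1 then t else t - 2)

/-- The backward messages of the walk with an inserted backward step. -/
def insertionBackward (S : Matrix V V ℝ) (g : V → ℝ) (k i t : ℕ) : V → ℝ :=
  message S g (if t ≤ i + 1 then k - t else k + 2 - t)

theorem insertionForward_succ (hS : S.IsSymm) (hu : ∀ j x, 0 < message S f j x)
    (hv : ∀ j x, 0 < message S g j x) (hi : i < k) (t : ℕ) :
    insertionForward S f i (t + 1) = insertionForward S f i t ᵥ* insertionKernel S f g k i t := by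
  rcases lt_trichotomy t (i + 1) with ht | rfl | ht
  · rw [insertionKernel_of_ne ht.ne, insertionForward, insertionForward, if_pos (by omega),
      if_pos (by omega), message_succ_eq_vecMul hS]
  · funext y
    have cancel (x : V) : message S f (i + 1) x * insertionKernel S f g k i (i + 1) x y =
        message S g (k - (i + 1)) x * S x y * (message S f i y / message S g (k - i) y) := by
      rw [insertionKernel, Matrix.of_apply, if_pos rfl, insertionRatio]
      have := (hu (i + 1) x).ne'
      field_simp
    have collect : ∑ x, message S g (k - (i + 1)) x * S x y = message S g (k - i) y := by
      rw [show k - i = k - (i + 1) + 1 by omega, message_succ_eq_vecMul hS]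
      rfl
    rw [insertionForward, insertionForward, if_neg (by omega), if_pos le_rfl, Matrix.vecMul,
      dotProduct, sum_congr rfl fun x _ => cancel x, ← sum_mul, collect,
      mul_div_cancel₀ _ (hv _ _).ne']
    rfl
  · rw [insertionKernel_of_ne ht.ne', insertionForward, insertionForward, if_neg (by omega),
      if_neg (by omega), ← message_succ_eq_vecMul hS, show t + 1 - 2 = t - 2 + 1 by omega]

theorem insertionBackward_eq_mulVec (hu : ∀ j x, 0 < message S f j x)
    (hv : ∀ j x, 0 < message S g j x) (hi : i < k) {t : ℕ} (ht : t < k + 2) :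
    insertionBackward S g k i t =
      insertionKernel S f g k i t *ᵥ insertionBackward S g k i (t + 1) := by
  rcases lt_trichotomy t (i + 1) with hti | rfl | hti
  · rw [insertionKernel_of_ne hti.ne, insertionBackward, insertionBackward, if_pos (by omega),
      if_pos (by omega), ← message_succ, show k - t = k - (t + 1) + 1 by omega]
  · funext x
    have cancel (y : V) : insertionKernel S f g k i (i + 1) x y * message S g (k - i) y =
        S x y * message S f i y * (message S g (k - (i + 1)) x / message S f (i + 1) x) := by
      rw [insertionKernel, Matrix.of_apply, if_pos rfl, insertionRatio]
      have := (hv (k - i) y).ne'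
      field_simp
    have collect : ∑ y, S x y * message S f i y = message S f (i + 1) x := by
      rw [message_succ]
      rfl
    rw [insertionBackward, insertionBackward, if_pos le_rfl, if_neg (by omega), Matrix.mulVec,
      dotProduct, show k + 2 - (i + 1 + 1) = k - i by omega, sum_congr rfl fun y _ => cancel y,
      ← sum_mul, collect, mul_div_cancel₀ _ (hu _ _).ne']
  · rw [insertionKernel_of_ne hti.ne', insertionBackward, insertionBackward, if_neg (by omega),
      if_neg (by omega), ← message_succ, show k + 2 - t = k + 2 - (t + 1) + 1 by omega]

theorem sum_insertionDensity_mul (hS : S.IsSymm) (hu : ∀ j x, 0 < message S f j x)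
    (hv : ∀ j x, 0 < message S g j x) (hi : i < k) (t : Fin (k + 2 + 1)) (h : V → ℝ) :
    ∑ w, pathWeight (fun _ => S) f g w * insertionDensity S f g k i w * h (w t) =
      ∑ x, insertionForward S f i t x * insertionBackward S g k i t x * h x := by
  have marginal := sum_pathWeight_mul (insertionKernel S f g k i) (insertionForward S f i)
    (insertionBackward S g k i) (fun t _ => insertionForward_succ hS hu hv hi t)
    (fun t ht => insertionBackward_eq_mulVec hu hv hi ht) t h
  have forward_zero : insertionForward S f i 0 = f := by
    rw [insertionForward, if_pos (by omega), message_zero]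
  have backward_last : insertionBackward S g k i (k + 2) = g := by
    rw [insertionBackward, if_neg (by omega), Nat.sub_self, message_zero]
  simpa only [forward_zero, backward_last, pathWeight_insertionKernel] using marginal

theorem sum_insertionDensity (hS : S.IsSymm) (hu : ∀ j x, 0 < message S f j x)
    (hv : ∀ j x, 0 < message S g j x) (hi : i < k) :
    ∑ w, pathWeight (fun _ => S) f g w * insertionDensity S f g k i w = f ⬝ᵥ S ^ k *ᵥ g := by
  have marginal := sum_insertionDensity_mul hS hu hv hi 0 fun _ => 1
  simp only [mul_one, Fin.val_zero, insertionForward, insertionBackward, Nat.zero_le, if_true,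
    Nat.sub_zero] at marginal
  rw [marginal, ← zero_add k, ← message_dotProduct_message hS, zero_add]
  rfl

theorem sum_insertionDensity_fiber (hS : S.IsSymm) (hu : ∀ j x, 0 < message S f j x)
    (hv : ∀ j x, 0 < message S g j x) (hi : i < k) (t : Fin (k + 2 + 1)) (x : V) :
    ∑ w with w t = x, pathWeight (fun _ => S) f g w * insertionDensity S f g k i w =
      insertionForward S f i t x * insertionBackward S g k i t x := by
  have marginal := sum_insertionDensity_mul hS hu hv hi t fun y => if y = x then 1 else 0
  simp only [mul_ite, mul_one, mul_zero, sum_ite_eq', mem_univ, if_true] at marginal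
  rw [← marginal, sum_filter]

theorem log_insertionDensity (hu : ∀ j x, 0 < message S f j x) (hv : ∀ j x, 0 < message S g j x)
    (hi : i < k) (w : Fin (k + 2 + 1) → V) :
    log (insertionDensity S f g k i w) =
      (log (message S g (k - (i + 1)) (w ⟨i + 1, by omega⟩)) -
        log (message S f (i + 1) (w ⟨i + 1, by omega⟩))) -
      (log (message S g (k - i) (w ⟨i + 2, by omega⟩)) -
        log (message S f i (w ⟨i + 2, by omega⟩))) := by
  have hu' (j : ℕ) (x : V) := (hu j x).ne'
  have hv' (j : ℕ) (x : V) := (hv j x).ne'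
  rw [insertionDensity_eq hi, insertionRatio,
    log_div (mul_ne_zero (hv' _ _) (hu' _ _)) (mul_ne_zero (hu' _ _) (hv' _ _)),
    log_mul (hv' _ _) (hu' _ _), log_mul (hu' _ _) (hv' _ _)]
  ring

theorem weightedEntropy_insertionDensity (hS : S.IsSymm) (hu : ∀ j x, 0 < message S f j x)
    (hv : ∀ j x, 0 < message S g j x) (hi : i < k) :
    weightedEntropy (pathWeight (fun _ => S) f g) (insertionDensity S f g k i) =
      meanLogRatio (message S f i) (message S g (k - i)) -
        meanLogRatio (message S f (i + 1)) (message S g (k - (i + 1))) := by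
  have before := sum_insertionDensity_mul hS hu hv hi ⟨i + 1, by omega⟩
    fun x => log (message S g (k - (i + 1)) x) - log (message S f (i + 1) x)
  have after := sum_insertionDensity_mul hS hu hv hi ⟨i + 2, by omega⟩
    fun x => log (message S g (k - i) x) - log (message S f i x)
  simp only [insertionForward, insertionBackward, le_refl, if_true,
    show ¬ i + 2 ≤ i + 1 by omega, if_false, Nat.add_sub_cancel,
    show k + 2 - (i + 2) = k - i by omega] at before after
  rw [meanLogRatio, meanLogRatio, ← before, ← after, weightedEntropy, ← sum_sub_distrib]
  refine sum_congr rfl fun w _ => ?_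
  rw [negMulLog, log_insertionDensity hu hv hi]
  ring

theorem dyadicMean_weightedEntropy_insertionDensity (hS : S.IsSymm)
    (hu : ∀ j x, 0 < message S f j x) (hv : ∀ j x, 0 < message S g j x) {r : ℕ}
    (hr : 2 ^ r ≤ k) :
    dyadicMean (fun i => weightedEntropy (pathWeight (fun _ => S) f g)
        (insertionDensity S f g k i)) 0 r =
      ((2 : ℝ) ^ r)⁻¹ * (meanLogRatio f (message S g k) -
        meanLogRatio (message S f (2 ^ r)) (message S g (k - 2 ^ r))) := by
  have telescope := sum_range_sub'
    (fun i => meanLogRatio (message S f i) (message S g (k - i))) (2 ^ r)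
  rw [message_zero, Nat.sub_zero] at telescope
  rw [dyadicMean, ← telescope, smul_eq_mul]
  congr 1
  refine sum_congr rfl fun i hi => ?_
  rw [zero_add, weightedEntropy_insertionDensity hS hu hv ((mem_range.1 hi).trans_le hr)]

/-- At time `mid + 1` an insertion before `mid` makes the walk lag behind by two steps. -/
theorem exists_marginals_insertionDensity (hS : S.IsSymm) (hu : ∀ j x, 0 < message S f j x)
    (hv : ∀ j x, 0 < message S g j x) {mid : ℕ} (h₀ : 0 < mid) (hk : mid < k) :
    ∃ (τ : (Fin (k + 2 + 1) → V) → V) (P Q : V → ℝ),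
      (∀ i < mid, ∀ x, ∑ w with τ w = x,
        pathWeight (fun _ => S) f g w * insertionDensity S f g k i w = P x) ∧
      (∀ i, mid ≤ i → i < k → ∀ x, ∑ w with τ w = x,
        pathWeight (fun _ => S) f g w * insertionDensity S f g k i w = Q x) ∧
      ∑ x, √(P x) * √(Q x) ≤ √(f ⬝ᵥ S ^ (k + 2) *ᵥ g) * √(f ⬝ᵥ S ^ (k - 2) *ᵥ g) := by
  refine ⟨fun w => w ⟨mid + 1, by omega⟩,
    fun x => message S f (mid - 1) x * message S g (k + 1 - mid) x,
    fun x => message S f (mid + 1) x * message S g (k - (mid + 1)) x,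
    fun i hi x => ?_, fun i hi hik x => ?_, ?_⟩
  · rw [sum_insertionDensity_fiber hS hu hv (by omega), insertionForward, insertionBackward,
      if_neg (by simp; omega), if_neg (by simp; omega)]
    simp
  · rw [sum_insertionDensity_fiber hS hu hv hik, insertionForward, insertionBackward,
      if_pos (by simpa using hi), if_pos (by simpa using hi)]
  have hu' (j : ℕ) (x : V) := (hu j x).le
  have hv' (j : ℕ) (x : V) := (hv j x).le
  calc ∑ x, √(message S f (mid - 1) x * message S g (k + 1 - mid) x) *
        √(message S f (mid + 1) x * message S g (k - (mid + 1)) x)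
      = ∑ x, √(message S f (mid + 1) x * message S g (k + 1 - mid) x) *
        √(message S f (mid - 1) x * message S g (k - (mid + 1)) x) := by
        refine sum_congr rfl fun x _ => ?_
        simp only [sqrt_mul (hu' _ _)]
        ring
    _ ≤ √(message S f (mid + 1) ⬝ᵥ message S g (k + 1 - mid)) *
        √(message S f (mid - 1) ⬝ᵥ message S g (k - (mid + 1))) :=
        sum_sqrt_mul_sqrt_le _ (fun x => mul_nonneg (hu' _ _) (hv' _ _))
          fun x => mul_nonneg (hu' _ _) (hv' _ _)
    _ = √(f ⬝ᵥ S ^ (k + 2) *ᵥ g) * √(f ⬝ᵥ S ^ (k - 2) *ᵥ g) := by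
        rw [message_dotProduct_message hS, message_dotProduct_message hS,
          show mid + 1 + (k + 1 - mid) = k + 2 by omega,
          show mid - 1 + (k - (mid + 1)) = k - 2 by omega]

theorem sum_pathWeight_const (n : ℕ) :
    ∑ w : Fin (n + 1) → V, pathWeight (fun _ => S) f g w = f ⬝ᵥ S ^ n *ᵥ g := by
  have total := sum_pathWeight (n := n) (fun _ => S) f (fun t => message S g (n - t))
    fun t ht => by rw [← message_succ, show n - (t + 1) + 1 = n - t by omega]
  simp only [Nat.sub_self, message_zero, Nat.sub_zero] at total
  exact total

theorem dotProduct_pow_mulVec_pos [Nonempty V] (hS : S ∈ Matrix.rowStochastic ℝ V)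
    (hf : ∀ x, 0 < f x) (hg : ∀ x, 0 < g x) (j : ℕ) : 0 < f ⬝ᵥ S ^ j *ᵥ g :=
  sum_pos (fun x _ => mul_pos (hf x) (message_pos hS hg j x)) univ_nonempty

/-- The entropy of the mixture of the first `2 ^ r` insertions is at most that of all walks of
length `k + 2`, and at least the mean entropy of the insertions plus the gain from mixing. The
negative of this mean entropy telescopes, and is at most `2⁻ʳ` times the information. -/
theorem two_pow_mul_le_sideInfo_add [Nonempty V] (hS : S ∈ Matrix.rowStochastic ℝ V)
    (hS' : S.IsSymm) (hf : ∀ x, 0 < f x) (hg : ∀ x, 0 < g x) {r : ℕ} (hr : 2 ^ r ≤ k) :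
    2 ^ r * (r * ((f ⬝ᵥ S ^ k *ᵥ g) * log 2 -
        2 * (√(f ⬝ᵥ S ^ (k + 2) *ᵥ g) * √(f ⬝ᵥ S ^ (k - 2) *ᵥ g))) -
      (f ⬝ᵥ S ^ k *ᵥ g) * log ((f ⬝ᵥ S ^ (k + 2) *ᵥ g) / (f ⬝ᵥ S ^ k *ᵥ g))) ≤
      sideInfo (S ^ k) f g + sideInfo (S ^ k) g f := by
  have hu := message_pos hS hf
  have hv := message_pos hS hg
  have hR : ∀ w : Fin (k + 2 + 1) → V, 0 ≤ pathWeight (fun _ => S) f g w :=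
    pathWeight_nonneg (fun _ _ _ => Matrix.nonneg_of_mem_rowStochastic hS) (fun x => (hf x).le)
      fun x => (hg x).le
  have hψ (i : ℕ) (w : Fin (k + 2 + 1) → V) : 0 ≤ insertionDensity S f g k i w :=
    (insertionDensity_pos hu hv w).le
  have hmass (i : ℕ) (hi : i < k) := sum_insertionDensity hS' hu hv hi
  have lower := dyadicMean_weightedEntropy_add_le hR hψ hmass (fun a r ha =>
    sum_mul_sqrt_dyadicMean_le hR hψ
      (fun mid => exists_marginals_insertionDensity hS' hu hv (mid := mid)) ha) r 0 (by omega)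
  have upper := weightedEntropy_le hR
    ((dotProduct_pow_mulVec_pos hS hf hg _).trans_eq (sum_pathWeight_const _).symm)
    (dyadicMean_nonneg hψ 0 r)
  rw [sum_mul_dyadicMean fun i _ hi => hmass i (by omega), sum_pathWeight_const] at upper
  rw [dyadicMean_weightedEntropy_insertionDensity hS' hu hv hr] at lower
  have mono := meanLogRatio_message_le hS hS' hf hg hr
  have ends : meanLogRatio (message S f k) g - meanLogRatio f (message S g k) =
      sideInfo (S ^ k) f g + sideInfo (S ^ k) g f :=
    meanLogRatio_mulVec_sub (hS'.pow k) f g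
  have bound := lower.trans upper
  rw [← le_sub_iff_add_le, inv_mul_le_iff₀ (by positivity)] at bound
  rw [← ends]
  linarith

end Insertion

/-! ### Information from a contrast between distances -/

section Contrast

variable {V : Type*} [Fintype V] [DecidableEq V] {S : Matrix V V ℝ} {f g : V → ℝ} {k : ℕ} {ε : ℝ}

/-- The power `S ^ (k - 2)`, which is `0` if `k < 2`. -/
def powSubTwo (S : Matrix V V ℝ) (k : ℕ) : Matrix V V ℝ :=
  if 2 ≤ k then S ^ (k - 2) else 0

/-- The `k`-step kernel, penalized by the kernels of the walks of length `k + 2` and `k - 2`. The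
form `f ⬝ᵥ contrast S k ε *ᵥ g` can be positive only if both penalties are at most `ε` times the
weight of the walks of length `k`. -/
noncomputable def contrast (S : Matrix V V ℝ) (k : ℕ) (ε : ℝ) : Matrix V V ℝ :=
  S ^ k - ε⁻¹ • (S ^ (k + 2) + powSubTwo S k)

theorem dotProduct_contrast_mulVec (f g : V → ℝ) :
    f ⬝ᵥ contrast S k ε *ᵥ g =
      f ⬝ᵥ S ^ k *ᵥ g - ε⁻¹ * (f ⬝ᵥ S ^ (k + 2) *ᵥ g + f ⬝ᵥ powSubTwo S k *ᵥ g) := by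
  simp only [contrast, Matrix.sub_mulVec, Matrix.smul_mulVec, Matrix.add_mulVec, dotProduct_sub,
    dotProduct_smul, dotProduct_add, smul_eq_mul]

theorem powSubTwo_nonneg (hS : S ∈ Matrix.rowStochastic ℝ V) (x y : V) :
    0 ≤ powSubTwo S k x y := by
  rw [powSubTwo]
  split_ifs
  · exact Matrix.nonneg_of_mem_rowStochastic (pow_mem hS _)
  · exact le_rfl

theorem mul_log_div_le_two_pow_mul (hk : k ≠ 0) (hε : 0 < ε) (hε' : ε ≤ 1 / 16) :
    k / 4 * log (k / ε) ≤
      2 ^ Nat.log 2 k * (Nat.log 2 k * (log 2 - 2 * ε) - log ε) := by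
  set r := Nat.log 2 k
  have hk₁ : (1 : ℝ) ≤ k := mod_cast Nat.one_le_iff_ne_zero.2 hk
  have hk₂ : (k : ℝ) ≤ 2 ^ (r + 1) := mod_cast (Nat.lt_pow_succ_log_self one_lt_two k).le
  have log_k : log k ≤ (r + 1) * log 2 := by
    simpa only [log_pow, Nat.cast_succ] using log_le_log (by linarith) hk₂
  have log_ε : log ε ≤ -(4 * log 2) := by
    calc log ε ≤ log (2 ^ 4)⁻¹ := log_le_log hε (by norm_num; linarith)
      _ = -(4 * log 2) := by rw [log_inv, log_pow, Nat.cast_ofNat]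
  have gain : r * (log 2 / 2) ≤ r * (log 2 - 2 * ε) :=
    mul_le_mul_of_nonneg_left (by linarith [log_two_gt_d9]) (Nat.cast_nonneg r)
  have log_two := log_two_gt_d9
  rw [log_div (by linarith) hε.ne']
  calc k / 4 * (log k - log ε) = k / 2 * ((log k - log ε) / 2) := by ring
    _ ≤ 2 ^ r * ((log k - log ε) / 2) := by
        refine mul_le_mul_of_nonneg_right (by rw [pow_succ] at hk₂; linarith) ?_
        linarith [log_nonneg hk₁]
    _ ≤ 2 ^ r * (r * (log 2 - 2 * ε) - log ε) :=
        mul_le_mul_of_nonneg_left (by linarith) (by positivity)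

theorem mul_log_div_nonneg (k : ℕ) (hε : 0 < ε) (hε' : ε ≤ 1) : 0 ≤ k / 4 * log (k / ε) := by
  rcases k.eq_zero_or_pos with rfl | hk
  · simp
  · have hk₁ : (1 : ℝ) ≤ k := mod_cast hk
    exact mul_nonneg (by positivity) (log_nonneg ((one_le_div hε).2 (hε'.trans hk₁)))

theorem log_mul_mulVec_le_sideInfo_add [Nonempty V] (hS : S ∈ Matrix.rowStochastic ℝ V)
    (hS' : S.IsSymm) (hk : k ≠ 0) (hε : 0 < ε) (hε' : ε ≤ 1 / 16) (hf : ∀ x, 0 < f x)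
    (hg : ∀ x, 0 < g x) (above : f ⬝ᵥ S ^ (k + 2) *ᵥ g ≤ ε * (f ⬝ᵥ S ^ k *ᵥ g))
    (below : f ⬝ᵥ powSubTwo S k *ᵥ g ≤ ε * (f ⬝ᵥ S ^ k *ᵥ g)) :
    k / 4 * log (k / ε) * (f ⬝ᵥ S ^ k *ᵥ g) ≤
      sideInfo (S ^ k) f g + sideInfo (S ^ k) g f := by
  have mass_pos := dotProduct_pow_mulVec_pos hS hf hg
  set r := Nat.log 2 k
  have overlap : r * (√(f ⬝ᵥ S ^ (k + 2) *ᵥ g) * √(f ⬝ᵥ S ^ (k - 2) *ᵥ g)) ≤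
      r * (ε * (f ⬝ᵥ S ^ k *ᵥ g)) := by
    rcases lt_or_ge k 2 with hk₂ | hk₂
    · simp [r, Nat.log_of_lt hk₂]
    · rw [powSubTwo, if_pos hk₂] at below
      refine mul_le_mul_of_nonneg_left ?_ (Nat.cast_nonneg r)
      exact (mul_le_mul (sqrt_le_sqrt above) (sqrt_le_sqrt below) (sqrt_nonneg _)
        (sqrt_nonneg _)).trans_eq (mul_self_sqrt (mul_nonneg hε.le (mass_pos k).le))
  have log_ratio : log (f ⬝ᵥ S ^ (k + 2) *ᵥ g / f ⬝ᵥ S ^ k *ᵥ g) ≤ log ε :=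
    log_le_log (div_pos (mass_pos _) (mass_pos _)) ((div_le_iff₀ (mass_pos k)).2 above)
  calc k / 4 * log (k / ε) * (f ⬝ᵥ S ^ k *ᵥ g)
      ≤ 2 ^ r * (r * (log 2 - 2 * ε) - log ε) * (f ⬝ᵥ S ^ k *ᵥ g) :=
        mul_le_mul_of_nonneg_right (mul_log_div_le_two_pow_mul hk hε hε') (mass_pos k).le
    _ ≤ 2 ^ r * (r * ((f ⬝ᵥ S ^ k *ᵥ g) * log 2 -
          2 * (√(f ⬝ᵥ S ^ (k + 2) *ᵥ g) * √(f ⬝ᵥ S ^ (k - 2) *ᵥ g))) -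
        (f ⬝ᵥ S ^ k *ᵥ g) * log ((f ⬝ᵥ S ^ (k + 2) *ᵥ g) / (f ⬝ᵥ S ^ k *ᵥ g))) := by
        rw [mul_assoc]
        refine mul_le_mul_of_nonneg_left ?_ (by positivity)
        linarith [mul_le_mul_of_nonneg_left log_ratio (mass_pos k).le]
    _ ≤ _ := two_pow_mul_le_sideInfo_add hS hS' hf hg (Nat.pow_log_le_self 2 hk)

theorem log_mul_contrast_le_sideInfo_add_of_pos [Nonempty V] (hS : S ∈ Matrix.rowStochastic ℝ V)
    (hS' : S.IsSymm) (hk : k ≠ 0) (hε : 0 < ε) (hε' : ε ≤ 1 / 16) (hf : ∀ x, 0 < f x)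
    (hg : ∀ x, 0 < g x) :
    k / 4 * log (k / ε) * (f ⬝ᵥ contrast S k ε *ᵥ g) ≤
      sideInfo (S ^ k) f g + sideInfo (S ^ k) g f := by
  have hf' (x : V) := (hf x).le
  have hg' (x : V) := (hg x).le
  have below_nonneg : 0 ≤ f ⬝ᵥ powSubTwo S k *ᵥ g :=
    dotProduct_mulVec_nonneg (powSubTwo_nonneg hS) hf' hg'
  have above_nonneg := (dotProduct_pow_mulVec_pos hS hf hg (k + 2)).le
  have factor_nonneg := mul_log_div_nonneg k hε (by linarith)
  rw [dotProduct_contrast_mulVec]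
  by_cases small : f ⬝ᵥ S ^ (k + 2) *ᵥ g ≤ ε * (f ⬝ᵥ S ^ k *ᵥ g) ∧
      f ⬝ᵥ powSubTwo S k *ᵥ g ≤ ε * (f ⬝ᵥ S ^ k *ᵥ g)
  · refine le_trans (mul_le_mul_of_nonneg_left ?_ factor_nonneg)
      (log_mul_mulVec_le_sideInfo_add hS hS' hk hε hε' hf hg small.1 small.2)
    exact sub_le_self _ (mul_nonneg (inv_nonneg.2 hε.le) (add_nonneg above_nonneg below_nonneg))
  · have hSk := pow_mem hS k
    have hSk₀ (x y : V) : 0 ≤ (S ^ k) x y := Matrix.nonneg_of_mem_rowStochastic hSk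
    have info_nonneg := add_nonneg
      (sideInfo_nonneg hSk₀ (Matrix.sum_row_of_mem_rowStochastic hSk) hf' hg')
      (sideInfo_nonneg hSk₀ (Matrix.sum_row_of_mem_rowStochastic hSk) hg' hf')
    refine (mul_nonpos_of_nonneg_of_nonpos factor_nonneg ?_).trans info_nonneg
    rw [sub_nonpos, le_inv_mul_iff₀ hε]
    rcases not_and_or.1 small with large | large <;> linarith

theorem log_mul_contrast_le_sideInfo_add [Nonempty V] (hS : S ∈ Matrix.rowStochastic ℝ V)
    (hS' : S.IsSymm) (hk : k ≠ 0) (hε : 0 < ε) (hε' : ε ≤ 1 / 16) (hf : ∀ x, 0 ≤ f x)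
    (hg : ∀ x, 0 ≤ g x) :
    k / 4 * log (k / ε) * (f ⬝ᵥ contrast S k ε *ᵥ g) ≤
      sideInfo (S ^ k) f g + sideInfo (S ^ k) g f := by
  set shift : (V → ℝ) → ℝ → V → ℝ := fun h e x => h x + e
  have hshift (h : V → ℝ) : Continuous (shift h) := by fun_prop
  have left_cont : Continuous fun e =>
      k / 4 * log (k / ε) * (shift f e ⬝ᵥ contrast S k ε *ᵥ shift g e) := by
    fun_prop
  have right_cont : Continuous fun e =>
      sideInfo (S ^ k) (shift f e) (shift g e) + sideInfo (S ^ k) (shift g e) (shift f e) :=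
    ((continuous_sideInfo (S ^ k)).comp ((hshift f).prodMk (hshift g))).add
      ((continuous_sideInfo (S ^ k)).comp ((hshift g).prodMk (hshift f)))
  have shift_zero (h : V → ℝ) : shift h 0 = h := funext fun x => add_zero (h x)
  have bound := le_of_tendsto_of_tendsto (b := nhdsWithin 0 (Set.Ioi 0))
    (left_cont.tendsto 0 |>.mono_left nhdsWithin_le_nhds)
    (right_cont.tendsto 0 |>.mono_left nhdsWithin_le_nhds) <| by
      filter_upwards [self_mem_nhdsWithin] with e he
      exact log_mul_contrast_le_sideInfo_add_of_pos hS hS' hk hε hε'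
        (fun x => add_pos_of_nonneg_of_pos (hf x) he) fun x => add_pos_of_nonneg_of_pos (hg x) he
  simpa only [shift_zero] using bound

end Contrast

/-! ### Probability mass functions -/

section PMFs

variable {α β : Type*}

theorem toReal_map_apply [DecidableEq β] (P : PMF α) (f : α → β) (F : Finset α)
    (hF : ∀ t ∉ F, P t = 0) (z : β) :
    (P.map f z).toReal = ∑ t ∈ F, if z = f t then (P t).toReal else 0 := by
  rw [PMF.map_apply, tsum_eq_sum (s := F) fun t ht => by simp [hF t ht],
    ENNReal.toReal_sum fun t _ => by split_ifs <;> simp [P.apply_ne_top]]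
  refine sum_congr rfl fun t _ => ?_
  by_cases h : z = f t <;> simp [h]

theorem map_apply_of_injective (P : PMF α) {f : α → β} (hf : f.Injective) (t : α) :
    P.map f (f t) = P t := by
  classical
  rw [PMF.map_apply, tsum_eq_single t fun s hs => if_neg fun h => hs (hf h.symm), if_pos rfl]

theorem map_apply_eq_zero (P : PMF α) {f : α → β} {z : β} (h : ∀ t, f t ≠ z) : P.map f z = 0 := by
  rw [PMF.apply_eq_zero_iff, PMF.mem_support_map_iff]
  rintro ⟨t, -, ht⟩
  exact h t ht

theorem toReal_true_add_toReal_false (p : PMF Bool) : (p true).toReal + (p false).toReal = 1 := by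
  have total := p.tsum_coe
  rw [tsum_bool, add_comm] at total
  rw [← ENNReal.toReal_add (p.apply_ne_top _) (p.apply_ne_top _), total, ENNReal.toReal_one]

theorem map_cons_apply_nil (P : PMF (List Bool × Bool)) (b o : Bool) :
    (P.map fun t => (b :: t.1, t.2)) ([], o) = 0 :=
  map_apply_eq_zero P fun _ h => List.cons_ne_nil _ _ (congr_arg Prod.fst h)

theorem map_cons_apply_cons (P : PMF (List Bool × Bool)) (b c : Bool) (l : List Bool) (o : Bool) :
    (P.map fun t => (b :: t.1, t.2)) (c :: l, o) = if b = c then P (l, o) else 0 := by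
  split_ifs with h
  · subst h
    exact map_apply_of_injective P (f := fun t : List Bool × Bool => (b :: t.1, t.2))
      (fun s t h => by simpa [Prod.ext_iff] using h) (l, o)
  · exact map_apply_eq_zero P fun _ ht => h (List.cons.inj (congr_arg Prod.fst ht)).1

theorem bind_map_cons_apply_nil (p : PMF Bool) (P : Bool → PMF (List Bool × Bool)) (o : Bool) :
    (p.bind fun b => (P b).map fun t => (b :: t.1, t.2)) ([], o) = 0 := by
  simp only [PMF.bind_apply, map_cons_apply_nil, mul_zero, tsum_zero]

theorem bind_map_cons_apply_cons (p : PMF Bool) (P : Bool → PMF (List Bool × Bool)) (c : Bool)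
    (l : List Bool) (o : Bool) :
    (p.bind fun b => (P b).map fun t => (b :: t.1, t.2)) (c :: l, o) = p c * P c (l, o) := by
  simp only [PMF.bind_apply, map_cons_apply_cons, mul_ite, mul_zero, tsum_ite_eq]

end PMFs

end InfoCost

/-! ### The rectangle property -/

namespace ProtocolTree

open Finset InfoCost

variable {X Y : Type}

/-- The transcripts of the leaves of a protocol tree. -/
def transcripts : ProtocolTree X Y → Finset (List Bool)
  | .aliceOutputs _ => {[]}
  | .bobOutputs _ => {[]}
  | .aliceSends _ next => univ.biUnion fun b => (next b).transcripts.image (List.cons b)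
  | .bobSends _ next => univ.biUnion fun b => (next b).transcripts.image (List.cons b)

/-- Alice's factor in the probability of a transcript and an output in `O`. -/
noncomputable def aliceWeight : ProtocolTree X Y → Finset Bool → List Bool → X → ℝ
  | .aliceOutputs f, O, s, x => if s = [] then ∑ o ∈ O, (biasedCoin (f x) o).toReal else 0
  | .bobOutputs _, _, s, _ => if s = [] then 1 else 0
  | .aliceSends _ _, _, [], _ => 0
  | .aliceSends p next, O, b :: s, x => (biasedCoin (p x) b).toReal * (next b).aliceWeight O s x
  | .bobSends _ _, _, [], _ => 0
  | .bobSends _ next, O, b :: s, x => (next b).aliceWeight O s x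

/-- Bob's factor in the probability of a transcript and an output in `O`. -/
noncomputable def bobWeight : ProtocolTree X Y → Finset Bool → List Bool → Y → ℝ
  | .aliceOutputs _, _, s, _ => if s = [] then 1 else 0
  | .bobOutputs g, O, s, y => if s = [] then ∑ o ∈ O, (biasedCoin (g y) o).toReal else 0
  | .aliceSends _ _, _, [], _ => 0
  | .aliceSends _ next, O, b :: s, y => (next b).bobWeight O s y
  | .bobSends _ _, _, [], _ => 0
  | .bobSends q next, O, b :: s, y => (biasedCoin (q y) b).toReal * (next b).bobWeight O s y

variable (T : ProtocolTree X Y) (O : Finset Bool) (s : List Bool) (x : X) (y : Y)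

theorem aliceWeight_nonneg : 0 ≤ T.aliceWeight O s x := by
  induction T generalizing s with
  | aliceOutputs f => rw [aliceWeight]; positivity
  | bobOutputs g => rw [aliceWeight]; positivity
  | aliceSends p next ih =>
    cases s with
    | nil => rw [aliceWeight]
    | cons b s => exact mul_nonneg ENNReal.toReal_nonneg (ih b s)
  | bobSends q next ih => cases s <;> simp only [aliceWeight, le_refl, ih]

theorem bobWeight_nonneg : 0 ≤ T.bobWeight O s y := by
  induction T generalizing s with
  | aliceOutputs f => rw [bobWeight]; positivity
  | bobOutputs g => rw [bobWeight]; positivity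
  | aliceSends p next ih => cases s <;> simp only [bobWeight, le_refl, ih]
  | bobSends q next ih =>
    cases s with
    | nil => rw [bobWeight]
    | cons b s => exact mul_nonneg ENNReal.toReal_nonneg (ih b s)

theorem sum_run_eq :
    ∑ o ∈ O, (T.run x y (s, o)).toReal = T.aliceWeight O s x * T.bobWeight O s y := by
  induction T generalizing s with
  | aliceOutputs f =>
    by_cases h : s = [] <;> simp [run, aliceWeight, bobWeight, h]
  | bobOutputs g =>
    by_cases h : s = [] <;> simp [run, aliceWeight, bobWeight, h]
  | aliceSends p next ih =>
    cases s with
    | nil => simp [run, aliceWeight]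
    | cons b s =>
      simp only [run, bind_map_cons_apply_cons, ENNReal.toReal_mul, ← mul_sum, ih, aliceWeight,
        bobWeight, mul_assoc]
  | bobSends q next ih =>
    cases s with
    | nil => simp [run, aliceWeight]
    | cons b s =>
      simp only [run, bind_map_cons_apply_cons, ENNReal.toReal_mul, ← mul_sum, ih, aliceWeight,
        bobWeight, mul_left_comm]

/-- Only one of the players declares the output. -/
theorem weight_univ_eq :
    (T.aliceWeight univ s = T.aliceWeight {true} s + T.aliceWeight {false} s ∧
        ∀ o, T.bobWeight {o} s = T.bobWeight univ s) ∨
      (T.bobWeight univ s = T.bobWeight {true} s + T.bobWeight {false} s ∧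
        ∀ o, T.aliceWeight {o} s = T.aliceWeight univ s) := by
  induction T generalizing s with
  | aliceOutputs f =>
    refine .inl ⟨funext fun x => ?_, fun o => rfl⟩
    by_cases h : s = [] <;> simp [aliceWeight, h]
  | bobOutputs g =>
    refine .inr ⟨funext fun y => ?_, fun o => rfl⟩
    by_cases h : s = [] <;> simp [bobWeight, h]
  | aliceSends p next ih =>
    cases s with
    | nil => exact .inl ⟨(add_zero 0).symm, fun o => rfl⟩
    | cons b s =>
      refine (ih b s).imp (fun h => ⟨funext fun x => ?_, h.2⟩) fun h =>
        ⟨h.1, fun o => funext fun x => ?_⟩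
      · simp only [aliceWeight, h.1, Pi.add_apply, mul_add]
      · simp only [aliceWeight, h.2 o]
  | bobSends q next ih =>
    cases s with
    | nil => exact .inl ⟨(add_zero 0).symm, fun o => rfl⟩
    | cons b s =>
      refine (ih b s).imp (fun h => ⟨h.1, fun o => funext fun y => ?_⟩) fun h =>
        ⟨funext fun y => ?_, h.2⟩
      · simp only [bobWeight, h.2 o]
      · simp only [bobWeight, h.1, Pi.add_apply, mul_add]

theorem transcript_eq :
    ((T.run x y).map Prod.fst s).toReal = T.aliceWeight univ s x * T.bobWeight univ s y := by
  have fst_apply : (T.run x y).map Prod.fst s = ∑ o, T.run x y (s, o) := by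
    rw [PMF.map_apply, ENNReal.tsum_prod', tsum_eq_single s fun t ht => by simp [ht.symm],
      tsum_fintype]
    simp only [if_true]
  rw [fst_apply, ENNReal.toReal_sum fun o _ => PMF.apply_ne_top _ _, sum_run_eq]

variable {s} in
theorem run_eq_zero (hs : s ∉ T.transcripts) (o : Bool) : T.run x y (s, o) = 0 := by
  induction T generalizing s with
  | aliceOutputs f => simp_all [run, transcripts]
  | bobOutputs g => simp_all [run, transcripts]
  | aliceSends p next ih =>
    cases s with
    | nil => rw [run, bind_map_cons_apply_nil]
    | cons b s =>
      rw [run, bind_map_cons_apply_cons, ih b, mul_zero]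
      contrapose! hs
      exact mem_biUnion.2 ⟨b, mem_univ b, mem_image_of_mem _ hs⟩
  | bobSends q next ih =>
    cases s with
    | nil => rw [run, bind_map_cons_apply_nil]
    | cons b s =>
      rw [run, bind_map_cons_apply_cons, ih b, mul_zero]
      contrapose! hs
      exact mem_biUnion.2 ⟨b, mem_univ b, mem_image_of_mem _ hs⟩

variable {s} in
theorem transcript_eq_zero (hs : s ∉ T.transcripts) : (T.run x y).map Prod.fst s = 0 := by
  rw [PMF.apply_eq_zero_iff, PMF.mem_support_map_iff]
  rintro ⟨⟨s, o⟩, ht, rfl⟩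
  exact ht (T.run_eq_zero x y hs o)

theorem sum_weight_mul_weight :
    ∑ s ∈ T.transcripts, T.aliceWeight univ s x * T.bobWeight univ s y = 1 := by
  have total := ((T.run x y).map Prod.fst).tsum_coe
  rw [tsum_eq_sum fun s hs => T.transcript_eq_zero x y hs] at total
  simp only [← transcript_eq]
  rw [← ENNReal.toReal_sum fun s _ => PMF.apply_ne_top _ _, total, ENNReal.toReal_one]

theorem output_eq (o : Bool) :
    ((T.run x y).map Prod.snd o).toReal =
      ∑ s ∈ T.transcripts, T.aliceWeight {o} s x * T.bobWeight {o} s y := by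
  rw [toReal_map_apply _ _ (T.transcripts ×ˢ univ), sum_product]
  · refine sum_congr rfl fun s _ => ?_
    rw [sum_ite_eq, if_pos (mem_univ o), ← sum_run_eq, sum_singleton]
  · rintro ⟨s, o⟩ hs
    exact T.run_eq_zero x y (fun h => hs (mem_product.2 ⟨h, mem_univ o⟩)) o

end ProtocolTree

namespace InfoCost

open Real Finset
open scoped Matrix

/-! ### The information cost of a protocol tree -/

section CondMutualInfo

variable {α V W : Type} {M : Matrix V W ℝ} {ρ : V → ℝ} {a : α → V → ℝ} {b : α → W → ℝ}
  {L : Finset α} {P : PMF (α × W × V)}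

theorem toReal_map_mid_right [Finite V] [Finite W] (hsum : ∀ x y, ∑ s ∈ L, a s x * b s y = 1)
    (hP : ∀ s y x, (P (s, y, x)).toReal = ρ x * M x y * (a s x * b s y))
    (hL : ∀ s ∉ L, ∀ z, P (s, z) = 0) (y : W) (x : V) :
    (P.map (fun s => s.2) (y, x)).toReal = ρ x * M x y := by
  classical
  have := Fintype.ofFinite V
  have := Fintype.ofFinite W
  rw [toReal_map_apply P _ (L ×ˢ univ) fun t ht => hL t.1 (by simpa using ht) t.2, sum_product]
  simp only [sum_ite_eq, mem_univ, if_true, hP, ← mul_sum, hsum, mul_one]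

theorem toReal_map_right [Finite V] [Fintype W] (hM₁ : ∀ x, ∑ y, M x y = 1)
    (hsum : ∀ x y, ∑ s ∈ L, a s x * b s y = 1)
    (hP : ∀ s y x, (P (s, y, x)).toReal = ρ x * M x y * (a s x * b s y))
    (hL : ∀ s ∉ L, ∀ z, P (s, z) = 0) (x : V) :
    (P.map (fun s => s.2.2) x).toReal = ρ x := by
  classical
  have := Fintype.ofFinite V
  rw [show (fun s : α × W × V => s.2.2) = Prod.snd ∘ fun s => s.2 from rfl, ← PMF.map_comp,
    toReal_map_apply _ _ univ (by simp), Fintype.sum_prod_type]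
  simp only [sum_ite_eq, mem_univ, if_true, toReal_map_mid_right hsum hP hL, ← mul_sum, hM₁,
    mul_one]

theorem toReal_map_left_right [Finite V] [Fintype W]
    (hP : ∀ s y x, (P (s, y, x)).toReal = ρ x * M x y * (a s x * b s y))
    (hL : ∀ s ∉ L, ∀ z, P (s, z) = 0) {s : α} (hs : s ∈ L) (x : V) :
    (P.map (fun s => (s.1, s.2.2)) (s, x)).toReal = ρ x * (a s x * (M *ᵥ b s) x) := by
  classical
  have := Fintype.ofFinite V
  rw [toReal_map_apply P _ (L ×ˢ univ) fun t ht => hL t.1 (by simpa using ht) t.2, sum_product,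
    sum_eq_single_of_mem s hs fun s' _ hs' => by simp [hs'.symm]]
  simp only [Fintype.sum_prod_type, Prod.mk.injEq, true_and, sum_ite_eq, mem_univ, if_true, hP,
    Matrix.mulVec, dotProduct, mul_sum]
  exact sum_congr rfl fun y _ => by ring

theorem mul_logb_posterior_div_prior {p m u v q : ℝ} (hq : m * v ≠ 0 → q ≠ 0) :
    p * m * (u * v) *
        logb 2 ((p * m * (u * v) / p) / ((p * (u * q) / p) * (p * m / p))) =
      p * u * (m * v * (log v - log q)) / log 2 := by
  rcases eq_or_ne (p * u * (m * v)) 0 with h | h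
  · rw [show p * m * (u * v) = p * u * (m * v) by ring, h, zero_mul, ← mul_assoc, h, zero_mul,
      zero_div]
  · obtain ⟨⟨hp, hu⟩, hm, hv⟩ : (p ≠ 0 ∧ u ≠ 0) ∧ m ≠ 0 ∧ v ≠ 0 := by
      simpa only [mul_ne_zero_iff] using h
    have hq' := hq (mul_ne_zero hm hv)
    rw [show p * m * (u * v) / p / (p * (u * q) / p * (p * m / p)) = v / q by field_simp, logb,
      log_div hv hq']
    ring

theorem condMutualInfo_eq_sum_sideInfo [Fintype V] [Fintype W]
    (hM : ∀ x y, 0 ≤ M x y) (hM₁ : ∀ x, ∑ y, M x y = 1) (hb : ∀ s y, 0 ≤ b s y)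
    (hsum : ∀ x y, ∑ s ∈ L, a s x * b s y = 1)
    (hP : ∀ s y x, (P (s, y, x)).toReal = ρ x * M x y * (a s x * b s y))
    (hL : ∀ s ∉ L, ∀ z, P (s, z) = 0) :
    condMutualInfo P = (∑ s ∈ L, sideInfo M (ρ * a s) (b s)) / log 2 := by
  rw [condMutualInfo, tsum_eq_sum (s := L ×ˢ univ) fun t ht => by
    rw [hL t.1 (by simpa using ht) t.2, ENNReal.toReal_zero, zero_mul], sum_product, sum_div]
  refine sum_congr rfl fun s hs => ?_
  have posterior_pos (x : V) (y : W) (h : M x y * b s y ≠ 0) : (M *ᵥ b s) x ≠ 0 :=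
    (((mul_nonneg (hM x y) (hb s y)).lt_of_ne' h).trans_le <|
      single_le_sum (f := fun y => M x y * b s y) (fun y _ => mul_nonneg (hM x y) (hb s y))
        (mem_univ y)).ne'
  simp only [Fintype.sum_prod_type, toReal_map_right hM₁ hsum hP hL,
    toReal_map_left_right hP hL hs, toReal_map_mid_right hsum hP hL, hP,
    mul_logb_posterior_div_prior (posterior_pos _ _)]
  rw [sum_comm, sideInfo, dotProduct, sum_div]
  refine sum_congr rfl fun x _ => ?_
  rw [← sum_div, ← mul_sum, Pi.mul_apply, Pi.sub_apply, Function.comp_apply, negMulLog]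
  congr 2
  simp only [Matrix.mulVec, dotProduct, Function.comp_apply, mul_sub, sum_sub_distrib, ← sum_mul,
    negMulLog, neg_mul, mul_neg, sum_neg_distrib, ← mul_assoc]
  ring

end CondMutualInfo

section Sums

variable {V W ι : Type*} [Fintype V] [Fintype W]

theorem sum_dotProduct_mulVec (L : Finset ι) (A : Matrix V W ℝ) (a : ι → V → ℝ)
    (b : ι → W → ℝ) :
    ∑ s ∈ L, a s ⬝ᵥ A *ᵥ b s = ∑ x, ∑ y, A x y * ∑ s ∈ L, a s x * b s y := by
  simp only [dotProduct, Matrix.mulVec, mul_sum]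
  rw [sum_comm]
  refine sum_congr rfl fun x _ => ?_
  rw [sum_comm]
  exact sum_congr rfl fun y _ => sum_congr rfl fun s _ => by ring

/-- The mean of `h x y` for a uniform `x` and weights `A x y` of `y` given `x`. -/
noncomputable def walkMean (A : Matrix V W ℝ) (h : V → W → ℝ) : ℝ :=
  (Fintype.card V : ℝ)⁻¹ * ∑ x, ∑ y, A x y * h x y

theorem walkMean_one [Nonempty V] {M : Matrix V W ℝ} (hM₁ : ∀ x, ∑ y, M x y = 1) :
    walkMean M (fun _ _ => 1) = 1 := by
  simp only [walkMean, mul_one, hM₁, sum_const, card_univ, nsmul_eq_mul]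
  exact inv_mul_cancel₀ (Nat.cast_ne_zero.2 Fintype.card_ne_zero)

end Sums

end InfoCost

namespace ProtocolTree

open Finset Real InfoCost
open scoped Matrix

theorem jointLaw_apply {X Y : Type} (T : ProtocolTree X Y) (μ : PMF (X × Y)) (x : X) (y : Y)
    (s : List Bool) :
    T.jointLaw μ (x, y, s) = μ (x, y) * (T.run x y).map Prod.fst s := by
  rw [jointLaw, PMF.bind_apply, tsum_eq_single (x, y)]
  · rw [← map_apply_of_injective ((T.run x y).map Prod.fst) (f := fun s => (x, y, s))
      (fun _ _ h => by simpa using h), PMF.map_comp]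
    rfl
  · rintro ⟨x', y'⟩ hne
    rw [map_apply_eq_zero _ fun t ht => hne ?_, mul_zero]
    simp only [Prod.mk.injEq] at ht ⊢
    exact ⟨ht.1, ht.2.1⟩

theorem jointLaw_map_swap_apply {X Y : Type} (T : ProtocolTree X Y) (μ : PMF (X × Y)) (x : X)
    (y : Y) (s : List Bool) :
    (T.jointLaw μ).map (fun t => (t.2.2, t.2.1, t.1)) (s, y, x) =
      μ (x, y) * (T.run x y).map Prod.fst s := by
  rw [← jointLaw_apply, ← map_apply_of_injective (T.jointLaw μ)
    (f := fun t : X × Y × List Bool => (t.2.2, t.2.1, t.1)) (by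
      rintro ⟨x, y, s⟩ ⟨x', y', s'⟩ h
      simp_all)]

theorem jointLaw_map_rotate_apply {X Y : Type} (T : ProtocolTree X Y) (μ : PMF (X × Y)) (x : X)
    (y : Y) (s : List Bool) :
    (T.jointLaw μ).map (fun t => (t.2.2, t.1, t.2.1)) (s, x, y) =
      μ (x, y) * (T.run x y).map Prod.fst s := by
  rw [← jointLaw_apply, ← map_apply_of_injective (T.jointLaw μ)
    (f := fun t : X × Y × List Bool => (t.2.2, t.1, t.2.1)) (by
      rintro ⟨x, y, s⟩ ⟨x', y', s'⟩ h
      simp_all)]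

theorem infoCost_eq_sum_sideInfo {X Y : Type} [Fintype X] [Fintype Y] (T : ProtocolTree X Y)
    {μ : PMF (X × Y)} {M : Matrix X Y ℝ} {N : Matrix Y X ℝ} {ρ : X → ℝ} {σ : Y → ℝ}
    (hM : ∀ x y, 0 ≤ M x y) (hM₁ : ∀ x, ∑ y, M x y = 1) (hN : ∀ y x, 0 ≤ N y x)
    (hN₁ : ∀ y, ∑ x, N y x = 1) (hμ : ∀ x y, (μ (x, y)).toReal = ρ x * M x y)
    (hμ' : ∀ x y, (μ (x, y)).toReal = σ y * N y x) :
    T.infoCost μ = (∑ s ∈ T.transcripts,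
      (sideInfo M (ρ * T.aliceWeight univ s) (T.bobWeight univ s) +
        sideInfo N (σ * T.bobWeight univ s) (T.aliceWeight univ s))) / log 2 := by
  have sum_weight_swap (y : Y) (x : X) :
      ∑ s ∈ T.transcripts, T.bobWeight univ s y * T.aliceWeight univ s x = 1 := by
    simpa only [mul_comm] using T.sum_weight_mul_weight x y
  rw [infoCost, condMutualInfo_eq_sum_sideInfo hM hM₁ (T.bobWeight_nonneg univ)
      T.sum_weight_mul_weight, condMutualInfo_eq_sum_sideInfo hN hN₁ (T.aliceWeight_nonneg univ)
      sum_weight_swap, ← add_div, sum_add_distrib]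
  · intro s x y
    rw [jointLaw_map_rotate_apply, ENNReal.toReal_mul, transcript_eq, hμ', mul_comm (bobWeight ..)]
  · rintro s hs ⟨x, y⟩
    rw [jointLaw_map_rotate_apply, T.transcript_eq_zero x y hs, mul_zero]
  · intro s y x
    rw [jointLaw_map_swap_apply, ENNReal.toReal_mul, transcript_eq, hμ]
  · rintro s hs ⟨y, x⟩
    rw [jointLaw_map_swap_apply, T.transcript_eq_zero x y hs, mul_zero]

section Uniform

variable {V : Type} [Fintype V] (T : ProtocolTree V V) {μ : PMF (V × V)} {M : Matrix V V ℝ}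

theorem infoCost_eq_of_uniform (hM : ∀ x y, 0 ≤ M x y) (hM₁ : ∀ x, ∑ y, M x y = 1)
    (hM' : M.IsSymm) (hμ : ∀ x y, (μ (x, y)).toReal = (Fintype.card V : ℝ)⁻¹ * M x y) :
    T.infoCost μ = (Fintype.card V : ℝ)⁻¹ * (∑ s ∈ T.transcripts,
      (sideInfo M (T.aliceWeight univ s) (T.bobWeight univ s) +
        sideInfo M (T.bobWeight univ s) (T.aliceWeight univ s))) / log 2 := by
  rw [T.infoCost_eq_sum_sideInfo hM hM₁ hM hM₁ hμ fun x y => by rw [hμ, hM'.apply y x], mul_sum]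
  simp only [mul_add, ← sideInfo_smul_left]
  rfl

theorem infoCost_nonneg (hM : ∀ x y, 0 ≤ M x y) (hM₁ : ∀ x, ∑ y, M x y = 1)
    (hM' : M.IsSymm) (hμ : ∀ x y, (μ (x, y)).toReal = (Fintype.card V : ℝ)⁻¹ * M x y) :
    0 ≤ T.infoCost μ := by
  rw [T.infoCost_eq_of_uniform hM hM₁ hM' hμ]
  have alice_nonneg (s : List Bool) := T.aliceWeight_nonneg univ s
  have bob_nonneg (s : List Bool) := T.bobWeight_nonneg univ s
  refine div_nonneg (mul_nonneg (by positivity) (sum_nonneg fun s _ => ?_))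
    (log_nonneg one_le_two)
  exact add_nonneg (sideInfo_nonneg hM hM₁ (alice_nonneg s) (bob_nonneg s))
    (sideInfo_nonneg hM hM₁ (bob_nonneg s) (alice_nonneg s))

/-- `I(Π ; Y | X) + I(Π ; X | Y) ≤ H(Y | X) + H(X | Y)`. -/
theorem infoCost_le (hM : ∀ x y, 0 ≤ M x y) (hM₁ : ∀ x, ∑ y, M x y = 1)
    (hM' : M.IsSymm) (hμ : ∀ x y, (μ (x, y)).toReal = (Fintype.card V : ℝ)⁻¹ * M x y) :
    T.infoCost μ ≤ 2 * walkMean (M.map negMulLog) (fun _ _ => 1) / log 2 := by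
  rw [T.infoCost_eq_of_uniform hM hM₁ hM' hμ]
  have alice_nonneg (s : List Bool) := T.aliceWeight_nonneg univ s
  have bob_nonneg (s : List Bool) := T.bobWeight_nonneg univ s
  have entropy_comm (s : List Bool) := mulVec_dotProduct_of_isSymm (hM'.map negMulLog)
    (T.bobWeight univ s) (T.aliceWeight univ s)
  have total : ∑ s ∈ T.transcripts, (sideInfo M (T.aliceWeight univ s) (T.bobWeight univ s) +
        sideInfo M (T.bobWeight univ s) (T.aliceWeight univ s)) ≤
      2 * ∑ x, ∑ y, M.map negMulLog x y * 1 := by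
    have joint : ∑ x, ∑ y, M.map negMulLog x y * 1 = ∑ s ∈ T.transcripts,
        T.aliceWeight univ s ⬝ᵥ M.map negMulLog *ᵥ T.bobWeight univ s := by
      simp only [sum_dotProduct_mulVec, T.sum_weight_mul_weight]
    rw [joint, mul_sum]
    refine sum_le_sum fun s _ => ?_
    rw [two_mul]
    refine add_le_add (sideInfo_le hM (alice_nonneg s) (bob_nonneg s))
      ((sideInfo_le hM (bob_nonneg s) (alice_nonneg s)).trans_eq ?_)
    rw [← entropy_comm, dotProduct_comm]
  rw [walkMean, mul_left_comm]
  gcongr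

end Uniform

end ProtocolTree

namespace InfoCost

open Finset Real
open scoped Matrix

section Announcement

variable {V : Type*} [Fintype V] {M : Matrix V V ℝ} {f f₁ f₂ g : V → ℝ}

/-- Of the two parts of a split observation, the first one reveals at most one bit more than the
unsplit observation: the information from the second part is nonnegative. -/
theorem sideInfo_add_le_of_eq_add (hM : ∀ x y, 0 ≤ M x y) (hM₁ : ∀ x, ∑ y, M x y = 1)
    (hf₁ : ∀ x, 0 ≤ f₁ x) (hf₂ : ∀ x, 0 ≤ f₂ x) (hg : ∀ x, 0 ≤ g x) (hf : f = f₁ + f₂) :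
    sideInfo M f₁ g + sideInfo M g f₁ ≤
      sideInfo M f g + sideInfo M g f + (g ⬝ᵥ M *ᵥ f) * log 2 := by
  subst hf
  linarith [sideInfo_add_left (M := M) (g := g) f₁ f₂, sideInfo_nonneg hM hM₁ hf₂ hg,
    sideInfo_nonneg hM hM₁ hg hf₂, sideInfo_add_sideInfo_le hM hg hf₁ hf₂]

end Announcement

end InfoCost

namespace ProtocolTree

open Finset Real InfoCost
open scoped Matrix

section Uniform

variable {V : Type} [Fintype V] (T : ProtocolTree V V) {μ : PMF (V × V)} {M S : Matrix V V ℝ}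
  {k : ℕ} {ε : ℝ}

/-- Announcing the output costs at most one bit. -/
theorem sideInfo_true_le (hM : ∀ x y, 0 ≤ M x y) (hM₁ : ∀ x, ∑ y, M x y = 1) (hM' : M.IsSymm)
    (s : List Bool) :
    sideInfo M (T.aliceWeight {true} s) (T.bobWeight {true} s) +
        sideInfo M (T.bobWeight {true} s) (T.aliceWeight {true} s) ≤
      sideInfo M (T.aliceWeight univ s) (T.bobWeight univ s) +
        sideInfo M (T.bobWeight univ s) (T.aliceWeight univ s) +
        (T.aliceWeight univ s ⬝ᵥ M *ᵥ T.bobWeight univ s) * log 2 := by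
  rcases T.weight_univ_eq s with ⟨split, same⟩ | ⟨split, same⟩
  · rw [same, ← mulVec_dotProduct_of_isSymm hM', dotProduct_comm]
    exact sideInfo_add_le_of_eq_add hM hM₁ (T.aliceWeight_nonneg _ s) (T.aliceWeight_nonneg _ s)
      (T.bobWeight_nonneg _ s) split
  · rw [same]
    linarith [sideInfo_add_le_of_eq_add hM hM₁ (T.bobWeight_nonneg _ s) (T.bobWeight_nonneg _ s)
      (T.aliceWeight_nonneg univ s) split]

theorem sum_aliceWeight_dotProduct_mulVec_bobWeight [Nonempty V] (hM₁ : ∀ x, ∑ y, M x y = 1) :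
    (Fintype.card V : ℝ)⁻¹ *
      ∑ s ∈ T.transcripts, T.aliceWeight univ s ⬝ᵥ M *ᵥ T.bobWeight univ s = 1 := by
  simp only [sum_dotProduct_mulVec, T.sum_weight_mul_weight]
  exact walkMean_one hM₁

theorem log_mul_walkMean_contrast_le [DecidableEq V] [Nonempty V]
    (hS : S ∈ Matrix.rowStochastic ℝ V) (hS' : S.IsSymm) (hk : k ≠ 0) (hε : 0 < ε)
    (hε' : ε ≤ 1 / 16)
    (hμ : ∀ x y, (μ (x, y)).toReal = (Fintype.card V : ℝ)⁻¹ * (S ^ k) x y) :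
    k / 4 * log (k / ε) *
        walkMean (contrast S k ε) (fun x y => ((T.run x y).map Prod.snd true).toReal) ≤
      (T.infoCost μ + 1) * log 2 := by
  have hSk := pow_mem hS k
  have nonneg (x y : V) : 0 ≤ (S ^ k) x y := Matrix.nonneg_of_mem_rowStochastic hSk
  have row_sum := Matrix.sum_row_of_mem_rowStochastic hSk
  have symm := hS'.pow k
  have leaf (s : List Bool) := (log_mul_contrast_le_sideInfo_add hS hS' hk hε hε'
    (T.aliceWeight_nonneg {true} s) (T.bobWeight_nonneg {true} s)).trans
      (T.sideInfo_true_le nonneg row_sum symm s)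
  have leaves := mul_le_mul_of_nonneg_left (sum_le_sum fun s (_ : s ∈ T.transcripts) => leaf s)
    (inv_nonneg.2 (Nat.cast_nonneg (α := ℝ) (Fintype.card V)))
  rw [sum_add_distrib, ← mul_sum, ← sum_mul, mul_add, ← mul_assoc _ _ (log 2),
    T.sum_aliceWeight_dotProduct_mulVec_bobWeight row_sum, mul_left_comm] at leaves
  simp only [walkMean, T.output_eq, ← sum_dotProduct_mulVec]
  rwa [T.infoCost_eq_of_uniform nonneg row_sum symm hμ, add_mul,
    div_mul_cancel₀ _ (log_pos one_lt_two).ne']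

end Uniform

end ProtocolTree

namespace InfoCost

open Finset Real
open scoped Matrix

/-! ### Randomized protocols -/

section Randomized

variable {V : Type} [Fintype V] {M S : Matrix V V ℝ} {μ : PMF (V × V)} {k : ℕ} {ε : ℝ}

theorem hasSum_toReal {α : Type*} (p : PMF α) : HasSum (fun a => (p a).toReal) 1 := by
  have total := ENNReal.hasSum_toReal (f := p) (by rw [p.tsum_coe]; exact ENNReal.one_ne_top)
  rwa [← ENNReal.tsum_toReal_eq p.apply_ne_top, p.tsum_coe, ENNReal.toReal_one] at total

theorem hasSum_toReal_bind_apply {α β : Type*} (p : PMF α) (f : α → PMF β) (b : β) :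
    HasSum (fun a => (p a).toReal * (f a b).toReal) (p.bind f b).toReal := by
  have total := ENNReal.hasSum_toReal (f := fun a => p a * f a b)
    (by rw [← PMF.bind_apply]; exact (p.bind f).apply_ne_top b)
  rw [PMF.bind_apply, ENNReal.tsum_toReal_eq fun a =>
    ENNReal.mul_ne_top (p.apply_ne_top a) ((f a).apply_ne_top b)]
  simpa only [ENNReal.toReal_mul] using total

theorem hasSum_walkMean_output (P : RandomizedProtocol V V) (A : Matrix V V ℝ) (o : Bool) :
    HasSum
      (fun T => (P T).toReal * walkMean A fun x y => ((T.run x y).map Prod.snd o).toReal)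
      (walkMean A fun x y => (P.output x y o).toReal) := by
  have termwise := (hasSum_sum (s := univ) fun x _ => hasSum_sum (s := univ) fun y _ =>
    (hasSum_toReal_bind_apply P (fun T => (T.run x y).map Prod.snd) o).mul_left (A x y)).mul_left
      (Fintype.card V : ℝ)⁻¹
  simpa only [walkMean, RandomizedProtocol.output, mul_left_comm (A _ _), ← mul_sum,
    mul_left_comm (Fintype.card V : ℝ)⁻¹] using termwise

theorem hasSum_infoCost (hM : ∀ x y, 0 ≤ M x y) (hM₁ : ∀ x, ∑ y, M x y = 1) (hM' : M.IsSymm)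
    (hμ : ∀ x y, (μ (x, y)).toReal = (Fintype.card V : ℝ)⁻¹ * M x y)
    (P : RandomizedProtocol V V) :
    HasSum (fun T => (P T).toReal * T.infoCost μ) (P.infoCost μ) :=
  (Summable.of_nonneg_of_le
    (fun T => mul_nonneg ENNReal.toReal_nonneg (T.infoCost_nonneg hM hM₁ hM' hμ))
    (fun T => mul_le_mul_of_nonneg_left (T.infoCost_le hM hM₁ hM' hμ) ENNReal.toReal_nonneg)
    ((hasSum_toReal P).summable.mul_right _)).hasSum

theorem logb_mul_walkMean_contrast_le [DecidableEq V] [Nonempty V]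
    (hS : S ∈ Matrix.rowStochastic ℝ V) (hS' : S.IsSymm) (hk : k ≠ 0) (hε : 0 < ε)
    (hε' : ε ≤ 1 / 16)
    (hμ : ∀ x y, (μ (x, y)).toReal = (Fintype.card V : ℝ)⁻¹ * (S ^ k) x y)
    (P : RandomizedProtocol V V) :
    k / 4 * logb 2 (k / ε) * walkMean (contrast S k ε) (fun x y => (P.output x y true).toReal) ≤
      P.infoCost μ + 1 := by
  have hSk := pow_mem hS k
  have cost := ((hasSum_infoCost (fun _ _ => Matrix.nonneg_of_mem_rowStochastic hSk)
    (Matrix.sum_row_of_mem_rowStochastic hSk) (hS'.pow k) hμ P).add (hasSum_toReal P)).mul_right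
      (log 2)
  have accept := (hasSum_walkMean_output P (contrast S k ε) true).mul_left (k / 4 * log (k / ε))
  have bound := hasSum_le (fun T => ?_) accept cost
  · rw [logb, mul_div_assoc', div_mul_eq_mul_div, div_le_iff₀ (log_pos one_lt_two)]
    exact bound
  · have tree := mul_le_mul_of_nonneg_left (T.log_mul_walkMean_contrast_le hS hS' hk hε hε' hμ)
      (ENNReal.toReal_nonneg (a := P T))
    linarith

end Randomized

/-! ### The random walk on the cube -/

section Cube

variable {n k : ℕ}

/-- The bit string `x` with coordinate `j` reversed. -/
def flipAt (x : Fin n → Bool) (j : Fin n) : Fin n → Bool :=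
  Function.update x j (!x j)

theorem flipAt_flipAt (x : Fin n → Bool) (j : Fin n) : flipAt (flipAt x j) j = x := by
  simp [flipAt]

theorem eq_flipAt_comm {x y : Fin n → Bool} {j : Fin n} : x = flipAt y j ↔ y = flipAt x j := by
  constructor <;> rintro rfl <;> exact (flipAt_flipAt _ j).symm

theorem flipCoords_zero (x : Fin n → Bool) (i : Fin 0 → Fin n) : flipCoords x i = x := by
  ext j
  simp [flipCoords]

theorem flipCoords_cons (x : Fin n → Bool) (j : Fin n) (i : Fin k → Fin n) :
    flipCoords x (Fin.cons j i : Fin (k + 1) → Fin n) = flipCoords (flipAt x j) i := by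
  ext l
  simp only [flipCoords, card_filter, Fin.sum_univ_succ, Fin.cons_zero, Fin.cons_succ, flipAt]
  rcases eq_or_ne j l with rfl | h
  · rw [if_pos rfl, Function.update_self]
    cases x j <;> simp [add_comm 1, Nat.odd_add_one, -Nat.not_odd_iff_even]
  · rw [if_neg h, zero_add, Function.update_of_ne h.symm]

theorem ne_flipCoords_iff {x : Fin n → Bool} {i : Fin k → Fin n} {j : Fin n} :
    x j ≠ flipCoords x i j ↔ Odd #{t | i t = j} := by
  rw [flipCoords]
  cases x j <;> simp

theorem hammingDist_flipCoords (x : Fin n → Bool) {i : Fin k → Fin n} (hi : i.Injective) :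
    hammingDist x (flipCoords x i) = k := by
  have flipped : ({j | x j ≠ flipCoords x i j} : Finset (Fin n)) = univ.image i := by
    ext j
    simp only [ne_flipCoords_iff, mem_filter_univ, mem_image, mem_univ, true_and]
    refine ⟨fun h => ?_, ?_⟩
    · obtain ⟨t, ht⟩ := card_pos.1 h.pos
      exact ⟨t, by simpa using ht⟩
    · rintro ⟨t, rfl⟩
      simp [hi.eq_iff, filter_eq']
  rw [hammingDist, flipped, card_image_of_injective _ hi, card_univ, Fintype.card_fin]

/-- The transition matrix of the simple random walk on the cube. -/
noncomputable def cubeWalk (n : ℕ) : Matrix (Fin n → Bool) (Fin n → Bool) ℝ :=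
  Matrix.of fun x y => (n : ℝ)⁻¹ * ∑ j, if y = flipAt x j then 1 else 0

theorem cubeWalk_mulVec (h : (Fin n → Bool) → ℝ) (x : Fin n → Bool) :
    (cubeWalk n *ᵥ h) x = (n : ℝ)⁻¹ * ∑ j, h (flipAt x j) := by
  simp only [Matrix.mulVec, dotProduct, cubeWalk, Matrix.of_apply, mul_assoc, ← mul_sum, sum_mul,
    ite_mul, one_mul, zero_mul]
  rw [sum_comm]
  simp

theorem cubeWalk_isSymm (n : ℕ) : (cubeWalk n).IsSymm := by
  ext x y
  simp only [Matrix.transpose_apply, cubeWalk, Matrix.of_apply, eq_flipAt_comm (x := x)]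

theorem cubeWalk_mem_rowStochastic [NeZero n] :
    cubeWalk n ∈ Matrix.rowStochastic ℝ (Fin n → Bool) := by
  refine ⟨fun x y => ?_, funext fun x => ?_⟩
  · rw [cubeWalk, Matrix.of_apply]
    positivity
  · rw [cubeWalk_mulVec]
    simp [NeZero.ne n]

theorem cubeWalk_pow_mulVec (k : ℕ) (h : (Fin n → Bool) → ℝ) (x : Fin n → Bool) :
    (cubeWalk n ^ k *ᵥ h) x = ((n : ℝ) ^ k)⁻¹ * ∑ i : Fin k → Fin n, h (flipCoords x i) := by
  induction k generalizing x with
  | zero => simp [flipCoords_zero]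
  | succ k ih =>
    rw [pow_succ', ← Matrix.mulVec_mulVec, cubeWalk_mulVec, sum_fin_succ_pi, pow_succ', mul_inv]
    simp only [ih, flipCoords_cons, ← mul_sum, mul_assoc]

theorem cubeWalk_pow_apply (k : ℕ) (x y : Fin n → Bool) :
    (cubeWalk n ^ k) x y =
      ((n : ℝ) ^ k)⁻¹ * ∑ i : Fin k → Fin n, if y = flipCoords x i then 1 else 0 := by
  rw [← cubeWalk_pow_mulVec k fun z => if y = z then 1 else 0]
  simp [Matrix.mulVec, dotProduct]

theorem walkPair_apply [NeZero n] (k : ℕ) (x y : Fin n → Bool) :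
    (walkPair n k (x, y)).toReal = (Fintype.card (Fin n → Bool) : ℝ)⁻¹ * (cubeWalk n ^ k) x y := by
  rw [walkPair, PMF.bind_apply, tsum_eq_single x fun x' hx' => by
      rw [map_apply_eq_zero _ fun t h => hx' (congr_arg Prod.fst h), mul_zero],
    ENNReal.toReal_mul, PMF.uniformOfFintype_apply, ENNReal.toReal_inv, ENNReal.toReal_natCast,
    toReal_map_apply _ _ univ (by simp), cubeWalk_pow_apply]
  simp [← sum_filter, mul_comm]

theorem one_sub_sq_div_le_descFactorial_div_pow [NeZero n] (k : ℕ) :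
    1 - (k : ℝ) ^ 2 / n ≤ n.descFactorial k / (n : ℝ) ^ k := by
  have hn : (0 : ℝ) < n := Nat.cast_pos.2 (NeZero.pos n)
  rcases le_or_gt k n with hk | hk
  · have hk' : (k : ℝ) ≤ n := Nat.cast_le.2 hk
    have bernoulli := one_add_mul_le_pow (a := (1 - k : ℝ) / n) (by
      rw [le_div_iff₀ hn]
      linarith) k
    have falling : (n + 1 - k : ℝ) ^ k ≤ n.descFactorial k := by
      have := Nat.pow_sub_le_descFactorial n k
      rw [← Nat.cast_le (α := ℝ), Nat.cast_pow, Nat.cast_sub (by omega)] at this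
      exact_mod_cast this
    calc 1 - (k : ℝ) ^ 2 / n ≤ 1 + k * ((1 - k) / n) := by
          have : (0 : ℝ) ≤ k / n := by positivity
          linarith [show (k : ℝ) * ((1 - k) / n) = k / n - k ^ 2 / n by ring]
      _ ≤ (1 + (1 - k) / n) ^ k := bernoulli
      _ = (n + 1 - k) ^ k / (n : ℝ) ^ k := by
          rw [← div_pow]
          congr 1
          field_simp
          ring
      _ ≤ _ := by gcongr
  · have hk' : (n : ℝ) ≤ k ^ 2 := by exact_mod_cast hk.le.trans (Nat.le_self_pow two_ne_zero k)
    exact (sub_nonpos.2 ((one_le_div hn).2 hk')).trans (by positivity)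

theorem inv_pow_mul_sum_not_injective_le [NeZero n] (k : ℕ) :
    ((n : ℝ) ^ k)⁻¹ * #{i : Fin k → Fin n | ¬ i.Injective} ≤ k ^ 2 / n := by
  have hn : (n : ℝ) ≠ 0 := Nat.cast_ne_zero.2 (NeZero.ne n)
  have injective : #{i : Fin k → Fin n | i.Injective} = n.descFactorial k := by
    rw [← Fintype.card_subtype, Fintype.card_congr (Equiv.subtypeInjectiveEquivEmbedding _ _),
      Fintype.card_embedding_eq, Fintype.card_fin, Fintype.card_fin]
  have total := card_filter_add_card_filter_not (s := univ) fun i : Fin k → Fin n => i.Injective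
  rw [injective, card_univ, Fintype.card_fun, Fintype.card_fin, Fintype.card_fin,
    ← Nat.cast_inj (R := ℝ), Nat.cast_add, Nat.cast_pow] at total
  rw [eq_sub_iff_add_eq'.2 total, mul_sub, inv_mul_cancel₀ (pow_ne_zero k hn), inv_mul_eq_div]
  linarith [one_sub_sq_div_le_descFactorial_div_pow (n := n) k]

end Cube

theorem walkMean_contrast {V : Type*} [Fintype V] [DecidableEq V] (S : Matrix V V ℝ) (k : ℕ)
    (ε : ℝ) (h : V → V → ℝ) :
    walkMean (contrast S k ε) h =
      walkMean (S ^ k) h - ε⁻¹ * (walkMean (S ^ (k + 2)) h + walkMean (powSubTwo S k) h) := by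
  simp only [walkMean, contrast, Matrix.sub_apply, Matrix.smul_apply, Matrix.add_apply, smul_eq_mul,
    sub_mul, add_mul, mul_assoc, sum_sub_distrib, sum_add_distrib, ← mul_sum]
  ring

section CubeMeans

variable {n k : ℕ} [NeZero n] {δ : ℝ} {h : (Fin n → Bool) → (Fin n → Bool) → ℝ}

theorem cubeWalk_pow_mulVec_le (hδ : 0 ≤ δ) {h : (Fin n → Bool) → ℝ} {x : Fin n → Bool}
    (hle : ∀ y, h y ≤ 1) (hx : ∀ y, hammingDist x y = k → h y ≤ δ) :
    (cubeWalk n ^ k *ᵥ h) x ≤ δ + k ^ 2 / n := by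
  have hn : (n : ℝ) ≠ 0 := Nat.cast_ne_zero.2 (NeZero.ne n)
  have pointwise (i : Fin k → Fin n) :
      h (flipCoords x i) ≤ δ + if ¬ i.Injective then 1 else 0 := by
    by_cases hi : i.Injective
    · simpa [hi] using hx _ (hammingDist_flipCoords x hi)
    · simpa [hi] using (hle _).trans (le_add_of_nonneg_left hδ)
  calc (cubeWalk n ^ k *ᵥ h) x
      = ((n : ℝ) ^ k)⁻¹ * ∑ i : Fin k → Fin n, h (flipCoords x i) := cubeWalk_pow_mulVec k h x
    _ ≤ ((n : ℝ) ^ k)⁻¹ * ∑ i : Fin k → Fin n, (δ + if ¬ i.Injective then 1 else 0) := by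
        gcongr with i
        exact pointwise i
    _ = δ + ((n : ℝ) ^ k)⁻¹ * #{i : Fin k → Fin n | ¬ i.Injective} := by
        rw [sum_add_distrib, sum_boole, mul_add, sum_const, card_univ, Fintype.card_fun,
          Fintype.card_fin, Fintype.card_fin, nsmul_eq_mul, Nat.cast_pow,
          inv_mul_cancel_left₀ (pow_ne_zero k hn)]
    _ ≤ δ + k ^ 2 / n := by
        gcongr
        exact inv_pow_mul_sum_not_injective_le k

theorem walkMean_cubeWalk_pow_le (hδ : 0 ≤ δ) (hle : ∀ x y, h x y ≤ 1)
    (hh : ∀ x y, hammingDist x y = k → h x y ≤ δ) :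
    walkMean (cubeWalk n ^ k) h ≤ δ + k ^ 2 / n := by
  rw [walkMean, inv_mul_le_iff₀ (by positivity), ← nsmul_eq_mul]
  exact sum_le_card_nsmul _ _ _ fun x _ => cubeWalk_pow_mulVec_le hδ (hle x) (hh x)

theorem le_walkMean_cubeWalk_pow (hδ : 0 ≤ δ) (hnonneg : ∀ x y, 0 ≤ h x y)
    (hh : ∀ x y, hammingDist x y = k → 1 - δ ≤ h x y) :
    1 - δ - k ^ 2 / n ≤ walkMean (cubeWalk n ^ k) h := by
  have complement := walkMean_cubeWalk_pow_le (n := n) hδ (h := fun x y => 1 - h x y)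
    (fun x y => sub_le_self 1 (hnonneg x y)) fun x y hxy => sub_le_comm.1 (hh x y hxy)
  have total := walkMean_one (Matrix.sum_row_of_mem_rowStochastic
    (pow_mem (cubeWalk_mem_rowStochastic (n := n)) k))
  have expand : walkMean (cubeWalk n ^ k) (fun x y => 1 - h x y) =
      walkMean (cubeWalk n ^ k) (fun _ _ => 1) - walkMean (cubeWalk n ^ k) h := by
    simp only [walkMean, mul_sub, sum_sub_distrib]
  linarith

theorem walkMean_powSubTwo_le (hδ : 0 ≤ δ) (hle : ∀ x y, h x y ≤ 1)
    (hh : ∀ x y, hammingDist x y + 2 = k → h x y ≤ δ) :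
    walkMean (powSubTwo (cubeWalk n) k) h ≤ δ + k ^ 2 / n := by
  rw [powSubTwo]
  split_ifs with hk
  · refine (walkMean_cubeWalk_pow_le hδ hle fun x y hxy => hh x y (by omega)).trans ?_
    gcongr
    omega
  · simp only [walkMean, Matrix.zero_apply, zero_mul, sum_const_zero, mul_zero]
    positivity

/-- The walks of length `k`, `k + 2` and `k - 2` see probabilities of acceptance of at least
`1 - 2δ`, at most `10δ` and at most `2δ`, so that the penalty in the contrast is at most `12/64`. -/
theorem half_le_walkMean_contrast_cubeWalk (hk : 1 ≤ k) (hδ : 0 < δ) (hδ' : δ ≤ 1 / 8)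
    (hkn : (k : ℝ) ^ 2 ≤ δ * n) (hnonneg : ∀ x y, 0 ≤ h x y) (hle : ∀ x y, h x y ≤ 1)
    (at_k : ∀ x y, hammingDist x y = k → 1 - δ ≤ h x y)
    (near_k : ∀ x y, hammingDist x y + 2 = k ∨ hammingDist x y = k + 2 → h x y ≤ δ) :
    1 / 2 ≤ walkMean (contrast (cubeWalk n) k (64 * δ)) h := by
  have hn : (0 : ℝ) < n := Nat.cast_pos.2 (NeZero.pos n)
  have collision : (k : ℝ) ^ 2 / n ≤ δ := (div_le_iff₀ hn).2 hkn
  have collision_add_two : ((k + 2 : ℕ) : ℝ) ^ 2 / n ≤ 9 * δ := by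
    have hk' : (1 : ℝ) ≤ k := Nat.one_le_cast.2 hk
    rw [div_le_iff₀ hn]
    push_cast
    nlinarith
  have main := le_walkMean_cubeWalk_pow (n := n) hδ.le hnonneg at_k
  have above := walkMean_cubeWalk_pow_le (n := n) hδ.le hle fun x y hxy => near_k x y (.inr hxy)
  have below := walkMean_powSubTwo_le (n := n) hδ.le hle fun x y hxy => near_k x y (.inl hxy)
  have penalty : (64 * δ)⁻¹ * (walkMean (cubeWalk n ^ (k + 2)) h +
      walkMean (powSubTwo (cubeWalk n) k) h) ≤ 12 / 64 := by
    rw [inv_mul_le_iff₀ (by positivity)]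
    linarith
  rw [walkMean_contrast]
  linarith

end CubeMeans

theorem mul_logb_div_le {k δ : ℝ} (hk : 1 ≤ k) (hδ : 0 < δ) (hδ' : δ ≤ 1 / 2 ^ 20) :
    1 / 32 * (k * logb 2 (k / δ)) ≤ k / 4 * logb 2 (k / (64 * δ)) * (1 / 2) - 1 := by
  have large : 20 ≤ logb 2 (k / δ) := by
    rw [le_logb_iff_rpow_le one_lt_two (by positivity), le_div_iff₀ hδ]
    norm_num at hδ' ⊢
    linarith
  have shift : logb 2 (k / (64 * δ)) = logb 2 (k / δ) - 6 := by
    rw [mul_comm, ← div_div, logb_div (by positivity) (by norm_num),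
      show (64 : ℝ) = 2 ^ (6 : ℝ) by norm_num, logb_rpow two_pos (by norm_num)]
  rw [shift]
  nlinarith

end InfoCost

open InfoCost

theorem mainTheorem7 :
    ∃ c δ₀ : ℝ, 0 < c ∧ 0 < δ₀ ∧
      ∀ (n k : ℕ) [NeZero n] (δ : ℝ), 1 ≤ k → 0 < δ → δ ≤ δ₀ → (k : ℝ) ^ 2 ≤ δ * n →
        ∀ P : RandomizedProtocol (Fin n → Bool) (Fin n → Bool),
          (∀ x y : Fin n → Bool, hammingDist x y = k → 1 - δ ≤ (P.output x y true).toReal) →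
          (∀ x y : Fin n → Bool, hammingDist x y + 2 = k ∨ hammingDist x y = k + 2 →
            1 - δ ≤ (P.output x y false).toReal) →
          c * (k * Real.logb 2 (k / δ)) ≤ P.infoCost (walkPair n k) := by
  refine ⟨1 / 32, 1 / 2 ^ 20, by norm_num, by norm_num, ?_⟩
  intro n k _ δ hk hδ hδ' hkn P accepts rejects
  have hk' : (1 : ℝ) ≤ k := Nat.one_le_cast.2 hk
  have small : 64 * δ ≤ 1 / 16 := by linarith
  have output_sum (x y) := toReal_true_add_toReal_false (P.output x y)
  have contrast_ge := half_le_walkMean_contrast_cubeWalk hk hδ (by linarith) hkn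
    (fun _ _ => ENNReal.toReal_nonneg)
    (fun x y => by linarith [output_sum x y, ENNReal.toReal_nonneg (a := P.output x y false)])
    accepts fun x y hxy => by linarith [output_sum x y, rejects x y hxy]
  have cost_ge := logb_mul_walkMean_contrast_le cubeWalk_mem_rowStochastic (cubeWalk_isSymm n)
    (Nat.one_le_iff_ne_zero.1 hk) (by positivity) small (walkPair_apply k) P
  have factor_nonneg : 0 ≤ k / 4 * Real.logb 2 (k / (64 * δ)) :=
    mul_nonneg (by positivity) <| Real.logb_nonneg one_lt_two <|
      (one_le_div (by positivity)).2 (by linarith)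
  linarith [mul_logb_div_le hk' hδ hδ', mul_le_mul_of_nonneg_left contrast_ge factor_nonneg]
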